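/- **Setting.** For $A\in\mathbb{Z}^{m\times N}$, $b\in\mathbb{Z}^m$, $c\in\mathbb{Z}^N$ let $P=(x,A,b,c)$ be the linear program $\min c^{T}x$ subject to $Ax=b$, $x\ge 0$, and let $Sol^{\mathbb{R}}(P)$ and $Sol^{\mathbb{Z}}(P)$ be its sets of real and of integral feasible solutions. For $x,y\in\mathbb{R}^N$ write $x\sqsubseteq y$ if $x_jy_j\ge 0$ and $|x_j|\le|y_j|$ for all $j$. Let $proximity_\infty(P)$ be the infimum of all reals $\rho\ge 0$ such that for every $x^{frac}\in Sol^{\mathbb{R}}(P)$ and every $x^{int}\in Sol^{\mathbb{Z}}(P)$ there is $\tilde x^{int}\in Sol^{\mathbb{Z}}(P)$ with $$\|\tilde x^{int}-x^{frac}\|_\infty\le\rho\quad\text{and}\quad \tilde x^{int}-x^{frac}\sqsubseteq x^{int}-x^{frac}.$$ The matrix $A$ is *multistage stochastic* if there are blocks $A^{(1)},\dots,A^{(\ell)}$ of $A$ containing all its non-zero entries, such that each column of $A$ belongs to exactly one block, some block $A^{(i_0)}$ satisfies $row(A^{(i)})\subseteq row(A^{(i_0)})$ for all $i$, and for any two blocks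 the row sets are nested or disjoint. A *multistage tree* of $A$ is a rooted tree on the blocks in which the row set of each child is contained in the row set of its parent and different blocks of the same height (distance from the root) have disjoint row sets. It is assumed that all leaves have the same height $t$ and that all blocks of height $i$ have the same number $s_i$ of columns. Let $d=s_0+s_1+\dots+s_t$ and let $\Delta$ be the largest absolute value of an entry of $A$. **Lemma 2.4.** There is an absolute constant $C$ such that the following holds for every linear program $P=(x,A,b,c)$ with $A$ multistage stochastic and every multistage tree of $A$ as above. Put $$R=2^{(d\Delta)^{C\,d^{3t+1}}}.$$ 1. $proximity_\infty(P)\le R$. 2. For every $x^{frac}\in Sol^{\mathbb{R}}(P)$ and every $x^{int}\in Sol^{\mathbb{Z}}(P)$ there is $\tilde x^{int}\in Sol^{\mathbb{Z}}(P)$ with $\|\tilde x^{int}-x^{frac}\|_\infty\le R$ and $\tilde x^{int}-x^{frac}\sqsubseteq x^{int}-x^{frac}$. 3. If $Sol^{\mathbb{Z}}(P)\neq\emptyset$, then for every optimal solution $x^{*}$ of the linear program there is an optimal integral solution $z$ (that is, $z\in Sol^{\mathbb{Z}}(P)$ minimizes $c^{T}z$ over $Sol^{\mathbb{Z}}(P)$)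 with $\|z-x^{*}\|_\infty\le R$. -/

import Mathlib

open scoped ENNReal NNReal

/-- Data of the linear program `min cᵀx, A x = b, x ≥ 0` with integral `A`, `b`, `c`. -/
structure LinearProgram (m N : ℕ) where
  A : Matrix (Fin m) (Fin N) ℤ
  b : Fin m → ℤ
  c : Fin N → ℤ

/-- An integral vector viewed as a real vector (`Fin N → ℝ` carries the sup norm). -/
def toRealVec {N : ℕ} (x : Fin N → ℤ) : Fin N → ℝ := fun j => (x j : ℝ)

/-- The conformal order: `|x j| ≤ |y j|` and `x j`, `y j` have compatible signs, for all `j`. -/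
def IsConformalTo {N : ℕ} (x y : Fin N → ℝ) : Prop :=
  ∀ j, 0 ≤ x j * y j ∧ |x j| ≤ |y j|

/-- The largest absolute value of an entry of `A` (it is `0` if `A` has no entries). -/
def maxAbsEntry {m N : ℕ} (A : Matrix (Fin m) (Fin N) ℤ) : ℕ :=
  Finset.univ.sup fun i => Finset.univ.sup fun j => (A i j).natAbs

namespace LinearProgram

variable {m N : ℕ} (P : LinearProgram m N)

/-- The fractional solutions of `P`. -/
def fracSol : Set (Fin N → ℝ) :=
  {x | (∀ i, ∑ j, (P.A i j : ℝ) * x j = (P.b i : ℝ)) ∧ ∀ j, 0 ≤ x j}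

/-- The integral solutions of `P`. -/
def intSol : Set (Fin N → ℤ) :=
  {x | (∀ i, ∑ j, P.A i j * x j = P.b i) ∧ ∀ j, 0 ≤ x j}

/-- `x` is an optimal solution of the linear relaxation. -/
def IsOptimalFrac (x : Fin N → ℝ) : Prop :=
  x ∈ P.fracSol ∧ ∀ y ∈ P.fracSol, ∑ j, (P.c j : ℝ) * x j ≤ ∑ j, (P.c j : ℝ) * y j

/-- `x` is an optimal solution of the integer program. -/
def IsOptimalInt (x : Fin N → ℤ) : Prop :=
  x ∈ P.intSol ∧ ∀ y ∈ P.intSol, ∑ j, P.c j * x j ≤ ∑ j, P.c j * y j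

/-- For every fractional solution `x` and every integral solution `z` there is an integral
solution `z'` at `ℓ_∞`-distance at most `ρ` from `x` such that `z' - x` is conformal to
`z - x`. -/
def HasProximity (ρ : ℝ) : Prop :=
  ∀ x ∈ P.fracSol, ∀ z ∈ P.intSol, ∃ z' ∈ P.intSol,
    ‖toRealVec z' - x‖ ≤ ρ ∧ IsConformalTo (toRealVec z' - x) (toRealVec z - x)

/-- `proximity_∞(P)`: the infimum of the reals `ρ ≥ 0` with `P.HasProximity ρ`, taken in
`[0, ∞]`, so that it would be `∞` if there were no such `ρ`. -/
noncomputable def proximity : ℝ≥0∞ :=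
  ⨅ (ρ : ℝ≥0) (_ : P.HasProximity (ρ : ℝ)), (ρ : ℝ≥0∞)

end LinearProgram

/-- A decomposition of `A` into blocks that makes `A` multistage stochastic.  The blocks are
numbered by `Fin ℓ`; every column belongs to exactly one block, `rows k` is the set of row
indices of the block `k`, and all entries outside the blocks vanish. -/
structure BlockDecomposition {m N : ℕ} (A : Matrix (Fin m) (Fin N) ℤ) where
  ℓ : ℕ
  block : Fin N → Fin ℓ
  rows : Fin ℓ → Finset (Fin m)
  support : ∀ i j, A i j ≠ 0 → i ∈ rows (block j)
  exists_top : ∃ k₀, ∀ k, rows k ⊆ rows k₀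
  laminar : ∀ k k', rows k ⊆ rows k' ∨ rows k' ⊆ rows k ∨ Disjoint (rows k) (rows k')

/-- A multistage tree of a block decomposition: a rooted tree on the blocks whose edges lead
from a block to a block with a smaller (or equal) row set, and in which different blocks of the
same stage have disjoint row sets.  Then any two blocks neither of which is an ancestor of the
other have disjoint rows, so the tree is the one given by inclusion of the row sets; the datum
of `parent` only matters for breaking ties between equal row sets and for placing blocks
without rows.

`height k` is the distance of `k` from the root, all leaves have height `t`, and all blocks of
height `i` have the same number `s i` of columns. (`s i` is irrelevant for `i > t`.) -/
structure MultistageTree {m N : ℕ} {A : Matrix (Fin m) (Fin N) ℤ}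
    (B : BlockDecomposition A) where
  root : Fin B.ℓ
  parent : Fin B.ℓ → Fin B.ℓ
  height : Fin B.ℓ → ℕ
  height_eq_zero_iff : ∀ k, height k = 0 ↔ k = root
  height_parent : ∀ k, k ≠ root → height k = height (parent k) + 1
  rows_subset_parent : ∀ k, k ≠ root → B.rows k ⊆ B.rows (parent k)
  disjoint_rows : ∀ k k', height k = height k' → k ≠ k' → Disjoint (B.rows k) (B.rows k')
  t : ℕ
  height_le : ∀ k, height k ≤ t
  leaf_height : ∀ k, (∀ k', k' ≠ root → parent k' ≠ k) → height k = t
  s : ℕ → ℕ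
  card_columns : ∀ k, (Finset.univ.filter fun j => B.block j = k).card = s (height k)

/-- The number of columns along a path from the root to a leaf: `d = s 0 + ⋯ + s t`. -/
def MultistageTree.d {m N : ℕ} {A : Matrix (Fin m) (Fin N) ℤ} {B : BlockDecomposition A}
    (T : MultistageTree B) : ℕ :=
  ∑ i ∈ Finset.range (T.t + 1), T.s i

/-! Let `y = z - x` with `z` integral and `x` fractional; then `A y = 0`. If some `|y j|` exceeds
`R`, it suffices to find a nonzero integral `u` with `A u = 0` that is conformal to `y`: then `z -
u` is again an integral solution, lies between `x` and `z`, and is closer to `x` in the ℓ₁-norm by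
at least 1. Iterating gives the proximity bound (`hasProximity_of_exists_kernel_vector`). The
statement on optima follows by exchanging `z' - x` and `z - x`.

To find `u`, put `τ = |y j|` and consider all integral inequalities with bounded coefficients,
supported on one root path of the tree, which `y / τ` satisfies up to a small error. Among them are
the rows of `A` and their negatives, the sign conditions of `y`, the condition that coordinate `j`
is at least 1 in absolute value, and the vanishing of every coordinate where `|y i|` is below a
threshold `θ`. If `x` solves all of them, has common denominator `L`, and satisfies `L * |x i| ≤ θ`,
then `u = L x` works: where `|y i| < θ` it is zero, elsewhere its size is at most `θ ≤ |y i|`.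

Such an `x` is built from the root downwards (`exists_satisfiesForms`). Given values on the columns
of the ancestors, the columns of a block are filled in by a vertex of the remaining system. Were
that system infeasible, a Farkas certificate with few, small integral multipliers would combine its
inequalities into a violated one on the ancestors' columns, with larger coefficients and a larger
error; but the list of the parent already contains all of those (`exists_extension_satisfiesForms`).
Coefficient bounds and errors therefore grow towards the root. Since a vertex has denominators
depending only on the left-hand sides, `D!`, with `D` a bound on the determinants, serves all blocks
of one height at once, however many there are. This factorial is the source of the outer exponential
in `R`. -/

/-! ### Farkas' lemma by Fourier–Motzkin elimination. -/

theorem Finset.exists_between_of_forall_le (s t : Finset ℝ) (h : ∀ a ∈ s, ∀ b ∈ t, a ≤ b) :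
    ∃ x, (∀ a ∈ s, a ≤ x) ∧ ∀ b ∈ t, x ≤ b := by
  rcases s.eq_empty_or_nonempty with rfl | hs
  · rcases t.eq_empty_or_nonempty with rfl | ht
    · exact ⟨0, by simp, by simp⟩
    · exact ⟨t.min' ht, by simp, fun b hb => t.min'_le b hb⟩
  · exact ⟨s.max' hs, fun a ha => s.le_max' a ha, fun b hb => h _ (s.max'_mem hs) b hb⟩

/-- A pair `p` encodes the inequality `p.2 ≤ p.1 ⬝ w`, and the span over `ℝ≥0` is the cone of its
consequences; the second alternative is the contradiction `r ≤ 0`. The induction is on the set `J`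
of variables that may occur. -/
theorem farkas_alternative_span {ι : Type*} [Fintype ι] [DecidableEq ι] (J : Finset ι) :
    ∀ S : Finset ((ι → ℝ) × ℝ), (∀ p ∈ S, ∀ i ∉ J, p.1 i = 0) →
      (∃ w : ι → ℝ, ∀ p ∈ S, p.2 ≤ ∑ i, p.1 i * w i) ∨
      ∃ r : ℝ, 0 < r ∧ ((0 : ι → ℝ), r) ∈ Submodule.span ℝ≥0 (S : Set ((ι → ℝ) × ℝ)) := by
  classical
  induction J using Finset.induction_on with
  | empty =>
    intro S hS
    by_cases h : ∃ p ∈ S, 0 < p.2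
    · obtain ⟨p, hp, hpos⟩ := h
      refine Or.inr ⟨p.2, hpos, ?_⟩
      have : ((0 : ι → ℝ), p.2) = p := by
        ext i
        · simp [hS p hp i (by simp)]
        · rfl
      rw [this]
      exact Submodule.subset_span hp
    · push Not at h
      exact Or.inl ⟨0, fun p hp => by simpa using h p hp⟩
  | insert j J hj ih =>
    intro S hS
    -- For `p.1 j > 0 > q.1 j` both multipliers are positive and the variable `j` cancels: this
    -- compares a lower with an upper bound for `w j`.
    let comb : ((ι → ℝ) × ℝ) × ((ι → ℝ) × ℝ) → (ι → ℝ) × ℝ :=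
      fun pq => (-(pq.2.1 j)) • pq.1 + pq.1.1 j • pq.2
    let Sp := S.filter fun p => 0 < p.1 j
    let Sn := S.filter fun p => p.1 j < 0
    let S' := S.filter (fun p => p.1 j = 0) ∪ (Sp ×ˢ Sn).image comb
    have hspan : ∀ p ∈ S', p ∈ Submodule.span ℝ≥0 (S : Set ((ι → ℝ) × ℝ)) := by
      intro p hp
      rcases Finset.mem_union.1 hp with hp | hp
      · exact Submodule.subset_span (Finset.mem_filter.1 hp).1
      · obtain ⟨⟨a, b⟩, hab, rfl⟩ := Finset.mem_image.1 hp
        obtain ⟨ha, hb⟩ := Finset.mem_product.1 hab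
        obtain ⟨ha, ha'⟩ := Finset.mem_filter.1 ha
        obtain ⟨hb, hb'⟩ := Finset.mem_filter.1 hb
        have h1 := Submodule.smul_mem (Submodule.span ℝ≥0 (S : Set ((ι → ℝ) × ℝ)))
          (⟨-(b.1 j), by simpa using hb'.le⟩ : ℝ≥0) (Submodule.subset_span ha)
        have h2 := Submodule.smul_mem (Submodule.span ℝ≥0 (S : Set ((ι → ℝ) × ℝ)))
          (⟨a.1 j, ha'.le⟩ : ℝ≥0) (Submodule.subset_span hb)
        exact Submodule.add_mem _ h1 h2
    have hvan : ∀ p ∈ S', ∀ i ∉ J, p.1 i = 0 := by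
      intro p hp i hi
      rcases Finset.mem_union.1 hp with hp | hp
      · obtain ⟨hp, hp0⟩ := Finset.mem_filter.1 hp
        by_cases hij : i = j
        · exact hij ▸ hp0
        · exact hS p hp i (by simp [hij, hi])
      · obtain ⟨⟨a, b⟩, hab, rfl⟩ := Finset.mem_image.1 hp
        obtain ⟨ha, hb⟩ := Finset.mem_product.1 hab
        obtain ⟨ha, ha'⟩ := Finset.mem_filter.1 ha
        obtain ⟨hb, hb'⟩ := Finset.mem_filter.1 hb
        by_cases hij : i = j
        · subst hij; simp [comb]; ring
        · simp [comb, hS a ha i (by simp [hij, hi]), hS b hb i (by simp [hij, hi])]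
    rcases ih S' hvan with ⟨w, hw⟩ | ⟨r, hr, hmem⟩
    · left
      let val : (ι → ℝ) × ℝ → ℝ := fun p => (p.2 - ∑ i ∈ Finset.univ.erase j, p.1 i * w i) / p.1 j
      have hsplit : ∀ (p : (ι → ℝ) × ℝ) (w' : ι → ℝ),
          ∑ i, p.1 i * w' i = p.1 j * w' j + ∑ i ∈ Finset.univ.erase j, p.1 i * w' i :=
        fun p w' => (Finset.add_sum_erase _ _ (Finset.mem_univ j)).symm
      obtain ⟨x, hx1, hx2⟩ := Finset.exists_between_of_forall_le (Sp.image val) (Sn.image val) (by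
        intro u hu v hv
        obtain ⟨a, ha, rfl⟩ := Finset.mem_image.1 hu
        obtain ⟨b, hb, rfl⟩ := Finset.mem_image.1 hv
        have hab := hw (comb (a, b)) (Finset.mem_union_right _
          (Finset.mem_image_of_mem _ (Finset.mem_product.2 ⟨ha, hb⟩)))
        have ha' := (Finset.mem_filter.1 ha).2
        have hb' := (Finset.mem_filter.1 hb).2
        have e : ∑ i, (comb (a, b)).1 i * w i
            = -(b.1 j) * ∑ i, a.1 i * w i + a.1 j * ∑ i, b.1 i * w i := by
          simp only [Finset.mul_sum, ← Finset.sum_add_distrib]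
          exact Finset.sum_congr rfl fun i _ => by simp [comb]; ring
        rw [e, hsplit a, hsplit b] at hab
        simp only [comb, Prod.snd_add, Prod.smul_snd, smul_eq_mul] at hab
        simp only [val]
        rw [div_le_iff₀ ha', div_mul_eq_mul_div, le_div_iff_of_neg hb']
        nlinarith)
      refine ⟨Function.update w j x, fun p hp => ?_⟩
      have herase : ∑ i ∈ Finset.univ.erase j, p.1 i * Function.update w j x i
          = ∑ i ∈ Finset.univ.erase j, p.1 i * w i :=
        Finset.sum_congr rfl fun i hi => by
          rw [Function.update_of_ne (Finset.ne_of_mem_erase hi)]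
      rw [hsplit, herase, Function.update_self]
      rcases lt_trichotomy (p.1 j) 0 with h | h | h
      · have := hx2 _ (Finset.mem_image_of_mem val (Finset.mem_filter.2 ⟨hp, h⟩))
        simp only [val] at this
        rw [le_div_iff_of_neg h] at this
        linarith
      · have := hw p (Finset.mem_union_left _ (Finset.mem_filter.2 ⟨hp, h⟩))
        rw [hsplit, h] at this
        rw [h]
        linarith
      · have := hx1 _ (Finset.mem_image_of_mem val (Finset.mem_filter.2 ⟨hp, h⟩))
        simp only [val] at this
        rw [div_le_iff₀ h] at this
        linarith
    · exact Or.inr ⟨r, hr, Submodule.span_le.2 (fun p hp => hspan p hp) hmem⟩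

/-- Farkas' lemma: an infeasible system `β k ≤ a k ⬝ w` has a certificate of infeasibility. -/
theorem exists_farkas_certificate {ι κ : Type*} [Fintype ι] [Fintype κ] (a : κ → ι → ℝ) (β : κ → ℝ)
    (h : ¬ ∃ w : ι → ℝ, ∀ k, β k ≤ ∑ i, a k i * w i) :
    ∃ μ : κ → ℝ, (∀ k, 0 ≤ μ k) ∧ (∀ i, ∑ k, μ k * a k i = 0) ∧ 0 < ∑ k, μ k * β k := by
  classical
  rcases farkas_alternative_span Finset.univ (Finset.univ.image fun k => (a k, β k))
    (by simp) with ⟨w, hw⟩ | ⟨r, hr, hmem⟩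
  · exact absurd ⟨w, fun k => hw (a k, β k) (Finset.mem_image_of_mem _ (Finset.mem_univ k))⟩ h
  · have hc : ((Finset.univ.image fun k => (a k, β k) : Finset ((ι → ℝ) × ℝ)) :
        Set ((ι → ℝ) × ℝ)) = Set.range fun k => (a k, β k) := by simp
    rw [hc, Submodule.mem_span_range_iff_exists_fun] at hmem
    obtain ⟨μ, hμ⟩ := hmem
    have h1 := congrArg Prod.fst hμ
    have h2 := congrArg Prod.snd hμ
    refine ⟨fun k => (μ k : ℝ), fun k => (μ k).2, fun i => ?_, ?_⟩
    · have := congrFun h1 i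
      simpa [Prod.fst_sum, Finset.sum_apply, NNReal.smul_def] using this
    · simp only [Prod.snd_sum, Prod.smul_snd, NNReal.smul_def, smul_eq_mul] at h2
      rw [h2]; exact hr

/-! ### Siegel's lemma: small integral kernel vectors. -/

section
attribute [local instance] Matrix.seminormedAddCommGroup

/-- Siegel's lemma, with its exponent `a / (b - a)` coarsened to `b - 1`, where `a < b` are the
numbers of equations and unknowns. The case `a = 0` is separate because
`Int.Matrix.exists_ne_zero_int_vec_norm_le` needs an equation. -/
theorem exists_int_kernel_vector_of_card_lt {α β : Type*} [Fintype α] [Fintype β]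
    (A : α → β → ℤ) {M : ℕ} (hM : 1 ≤ M) (hA : ∀ i j, |A i j| ≤ M)
    (hcard : Fintype.card α < Fintype.card β) :
    ∃ t : β → ℤ, t ≠ 0 ∧ (∀ i, ∑ j, A i j * t j = 0) ∧
      ∀ j, |t j| ≤ ((Fintype.card β * M) ^ (Fintype.card β - 1) : ℕ) := by
  classical
  have hβ : 0 < Fintype.card β := by omega
  have hbase : 1 ≤ Fintype.card β * M := Nat.mul_pos hβ hM
  rcases Nat.eq_zero_or_pos (Fintype.card α) with h0 | h0
  · have : IsEmpty α := Fintype.card_eq_zero_iff.1 h0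
    obtain ⟨j₀⟩ : Nonempty β := Fintype.card_pos_iff.1 hβ
    have hpow : (1 : ℤ) ≤ ((Fintype.card β * M) ^ (Fintype.card β - 1) : ℕ) := by
      exact_mod_cast Nat.one_le_pow _ _ hbase
    refine ⟨Pi.single j₀ 1, by simp, fun i => (IsEmpty.false i).elim, fun j => ?_⟩
    by_cases h : j = j₀
    · subst h; simpa using hpow
    · simp [h]; positivity
  · obtain ⟨t, ht0, hker, hnorm⟩ :=
      Int.Matrix.exists_ne_zero_int_vec_norm_le (Matrix.of A) hcard h0
    refine ⟨t, ht0, fun i => ?_, fun j => ?_⟩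
    · have := congrFun hker i
      simpa [Matrix.mulVec, dotProduct] using this
    · have hAM : max 1 ‖Matrix.of A‖ ≤ (M : ℝ) := by
        refine max_le (by exact_mod_cast hM) ?_
        rw [Matrix.norm_le_iff (by positivity)]
        intro i j
        rw [Int.norm_eq_abs]
        exact_mod_cast hA i j
      have h1 : (1 : ℝ) ≤ (Fintype.card β : ℝ) * M := by exact_mod_cast hbase
      have hlt : (Fintype.card α : ℝ) + 1 ≤ Fintype.card β := by exact_mod_cast hcard
      have hexp : (Fintype.card α : ℝ) / (Fintype.card β - Fintype.card α)
          ≤ ((Fintype.card β - 1 : ℕ) : ℝ) := by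
        rw [Nat.cast_sub hβ, Nat.cast_one, div_le_iff₀ (by linarith)]
        have : (0 : ℝ) < Fintype.card α := by exact_mod_cast h0
        nlinarith
      have hR : ‖t‖ ≤ ((Fintype.card β : ℝ) * M) ^ (Fintype.card β - 1) := by
        calc ‖t‖ ≤ _ := hnorm
          _ ≤ ((Fintype.card β : ℝ) * M) ^
              ((Fintype.card α : ℝ) / (Fintype.card β - Fintype.card α)) := by
            refine Real.rpow_le_rpow (by positivity) (by gcongr) ?_
            exact div_nonneg (by positivity) (by linarith)
          _ ≤ ((Fintype.card β : ℝ) * M) ^ ((Fintype.card β - 1 : ℕ) : ℝ) :=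
            Real.rpow_le_rpow_of_exponent_le h1 hexp
          _ = _ := Real.rpow_natCast _ _
      have h2 := (norm_le_pi_norm t j).trans hR
      rw [Int.norm_eq_abs] at h2
      exact_mod_cast h2

end

/-- A system of integral linear equations with a nonzero real solution has a small nonzero
integral solution. -/
theorem exists_int_kernel_vector {α β : Type*} [Fintype α] [Fintype β]
    (A : α → β → ℤ) {M : ℕ} (hM : 1 ≤ M) (hA : ∀ i j, |A i j| ≤ M)
    (v : β → ℝ) (hv0 : v ≠ 0) (hv : ∀ i, ∑ j, (A i j : ℝ) * v j = 0) :
    ∃ t : β → ℤ, t ≠ 0 ∧ (∀ i, ∑ j, A i j * t j = 0) ∧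
      ∀ j, |t j| ≤ ((Fintype.card β * M) ^ (Fintype.card β - 1) : ℕ) := by
  classical
  let row : α → β → ℝ := fun i j => (A i j : ℝ)
  obtain ⟨γ, f, hf, hspan, hli⟩ := exists_linearIndependent' ℝ row
  have : Fintype γ := Fintype.ofInjective f hf
  have hdot : ∀ w : β → ℝ, ∀ u ∈ Submodule.span ℝ (Set.range (row ∘ f)),
      (∀ g, ∑ j, row (f g) j * w j = 0) → ∑ j, u j * w j = 0 := by
    intro w u hu hw
    induction hu using Submodule.span_induction with
    | mem x hx => obtain ⟨g, rfl⟩ := hx; exact hw g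
    | zero => simp
    | add x y _ _ hx hy => simp [add_mul, Finset.sum_add_distrib, hx, hy]
    | smul c x _ hx => simp [mul_assoc, ← Finset.mul_sum, hx]
  -- The independent rows cannot span the whole space, since then `v` would be orthogonal to itself.
  have hcard : Fintype.card γ < Fintype.card β := by
    rw [← finrank_span_eq_card hli, ← Module.finrank_fintype_fun_eq_card ℝ (η := β)]
    refine Submodule.finrank_lt fun htop => hv0 ?_
    have hvv := hdot v v (htop ▸ Submodule.mem_top) fun g => hv (f g)
    funext j
    exact mul_self_eq_zero.1
      ((Finset.sum_eq_zero_iff_of_nonneg fun j _ => mul_self_nonneg (v j)).1 hvv j (Finset.mem_univ j))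
  obtain ⟨t, ht0, hker, hbd⟩ := exists_int_kernel_vector_of_card_lt (fun g => A (f g)) hM
    (fun g => hA (f g)) hcard
  refine ⟨t, ht0, fun i => ?_, hbd⟩
  have := hdot (fun j => (t j : ℝ)) (row i) (hspan ▸ Submodule.subset_span ⟨i, rfl⟩)
    fun g => by simp only [row]; exact_mod_cast hker g
  simp only [row] at this
  exact_mod_cast this

/-! ### Small integral Farkas certificates. -/

/-- Farkas' lemma with a small integral certificate of small support. -/
theorem exists_bounded_farkas_certificate {ι κ : Type*} [Fintype ι] [Fintype κ]
    (a : κ → ι → ℤ) {M : ℕ} (hM : 1 ≤ M) (ha : ∀ k i, |a k i| ≤ M) (β : κ → ℝ)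
    (h : ¬ ∃ w : ι → ℝ, ∀ k, β k ≤ ∑ i, (a k i : ℝ) * w i) :
    ∃ (I : Finset κ) (μ : κ → ℤ), I.card ≤ Fintype.card ι + 1 ∧ (∀ k ∉ I, μ k = 0) ∧
      (∀ k, 0 ≤ μ k) ∧ (∀ k, μ k ≤ (((Fintype.card ι + 1) * M) ^ Fintype.card ι : ℕ)) ∧
      (∀ i, ∑ k, μ k * a k i = 0) ∧ 0 < ∑ k, (μ k : ℝ) * β k := by
  classical
  let Cert : (κ → ℝ) → Prop := fun μ =>
    (∀ k, 0 ≤ μ k) ∧ (∀ i, ∑ k, μ k * (a k i : ℝ) = 0) ∧ 0 < ∑ k, μ k * β k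
  let supp : (κ → ℝ) → Finset κ := fun μ => Finset.univ.filter fun k => μ k ≠ 0
  -- A certificate of minimal support is rigid: the next two facts restrict all relations supported
  -- in it.
  obtain ⟨μ, hμ, hmin⟩ : ∃ μ, Cert μ ∧ ∀ ν, Cert ν → (supp μ).card ≤ (supp ν).card := by
    have hne : {μ | Cert μ}.Nonempty := exists_farkas_certificate (fun k i => (a k i : ℝ)) β h
    exact ⟨Function.argminOn (fun μ => (supp μ).card) _ hne, Function.argminOn_mem _ _ hne,
      fun ν hν => Function.argminOn_le (fun μ => (supp μ).card) _ hν⟩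
  -- If `ν` had a negative entry, moving from `μ` along `ν` until the first coordinate vanishes
  -- would give a certificate of smaller support.
  have hnonneg : ∀ ν : κ → ℝ, (∀ k, μ k = 0 → ν k = 0) → (∀ i, ∑ k, ν k * (a k i : ℝ) = 0) →
      0 ≤ ∑ k, ν k * β k → ∀ k, 0 ≤ ν k := by
    intro ν hνs hνk hνβ
    by_contra! hneg
    obtain ⟨k₀, hk₀⟩ := hneg
    obtain ⟨k, hk, hkmin⟩ := Finset.exists_min_image (Finset.univ.filter fun k => ν k < 0)
      (fun k => μ k / (-ν k)) ⟨k₀, by simpa using hk₀⟩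
    have hk' : ν k < 0 := by simpa using hk
    set c := μ k / (-ν k) with hc
    have hc0 : 0 ≤ c := div_nonneg (hμ.1 k) (by linarith)
    have hcert : Cert (fun k => μ k + c * ν k) := by
      refine ⟨fun l => ?_, fun i => ?_, ?_⟩
      · rcases lt_or_ge (ν l) 0 with hl | hl
        · have := hkmin l (by simpa using hl)
          rw [le_div_iff₀ (by linarith)] at this
          linarith
        · have := hμ.1 l
          positivity
      · simp [add_mul, Finset.sum_add_distrib, mul_assoc, ← Finset.mul_sum, hνk i, hμ.2.1 i]
      · simp only [add_mul, Finset.sum_add_distrib, mul_assoc, ← Finset.mul_sum]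
        have := hμ.2.2
        positivity
    have hlt : (supp fun k => μ k + c * ν k).card < (supp μ).card := by
      refine Finset.card_lt_card (Finset.ssubset_iff_of_subset ?_ |>.2 ⟨k, ?_, ?_⟩)
      · intro l hl
        simp only [supp, Finset.mem_filter, Finset.mem_univ, true_and] at hl ⊢
        intro h0
        exact hl (by simp [h0, hνs l h0])
      · simp only [supp, Finset.mem_filter, Finset.mem_univ, true_and]
        exact fun h0 => hk'.ne (hνs k h0)
      · simp only [supp, Finset.mem_filter, Finset.mem_univ, true_and, not_not, hc]
        field_simp [hk'.ne]
        ring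
    exact absurd (hmin _ hcert) (not_le.2 hlt)
  have hzero : ∀ ν : κ → ℝ, (∀ k, μ k = 0 → ν k = 0) → (∀ i, ∑ k, ν k * (a k i : ℝ) = 0) →
      ∑ k, ν k * β k = 0 → ν = 0 := by
    intro ν h1 h2 h3
    funext k
    refine le_antisymm ?_ (hnonneg ν h1 h2 h3.ge k)
    have := hnonneg (-ν) (fun k hk => by simp [h1 k hk]) (fun i => by simp [h2 i])
      (by simp [h3]) k
    simpa using this
  let I := supp μ
  have hsum : ∀ (g : κ → ℝ) (ν : I → ℝ),
      ∑ k, (if hk : k ∈ I then ν ⟨k, hk⟩ else 0) * g k = ∑ k : I, ν k * g k := by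
    intro g ν
    rw [← Finset.sum_subset (Finset.subset_univ I), ← Finset.sum_coe_sort I]
    · exact Finset.sum_congr rfl fun k _ => by simp
    · intro k _ hk; simp [hk]
  have hoff : ∀ k, μ k = 0 → k ∉ I := fun k hk => by simp [I, supp, hk]
  -- By `hzero`, the map sending `ν` to its combined left-hand and right-hand sides is injective on
  -- vectors supported in `I`.
  have hcardI : I.card ≤ Fintype.card ι + 1 := by
    by_contra! hlt
    let φ : (I → ℝ) →ₗ[ℝ] (ι → ℝ) × ℝ :=
      { toFun := fun ν => (fun i => ∑ k : I, ν k * (a k i : ℝ), ∑ k : I, ν k * β k)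
        map_add' := fun x y => by
          ext <;> simp [add_mul, Finset.sum_add_distrib]
        map_smul' := fun c x => by
          ext <;> simp [mul_assoc, Finset.mul_sum] }
    have hker : LinearMap.ker φ ≠ ⊥ := LinearMap.ker_ne_bot_of_finrank_lt (by simpa using hlt)
    obtain ⟨ν, hν, hν0⟩ := (Submodule.ne_bot_iff _).1 hker
    have hφ : φ ν = 0 := hν
    have h1 := congrArg Prod.fst hφ
    have h2 := congrArg Prod.snd hφ
    refine hν0 ?_
    have := hzero (fun k => if hk : k ∈ I then ν ⟨k, hk⟩ else 0)
      (fun k hk => by simp [hoff k hk]) (fun i => by rw [hsum]; exact congrFun h1 i)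
      (by rw [hsum]; exact h2)
    funext k
    simpa using congrFun this k
  have hμpos : μ ≠ 0 := fun h0 => by
    have := hμ.2.2
    simp [h0] at this
  obtain ⟨t, ht0, htk, htb⟩ := exists_int_kernel_vector (fun (i : ι) (k : I) => a k i) hM
    (fun i k => ha k i) (fun k => μ k)
    (fun h0 => hμpos (funext fun k => by
      by_contra hk
      exact hk (congrFun h0 ⟨k, by simpa [I, supp] using hk⟩)))
    (fun i => by
      have h1 := hμ.2.1 i
      rw [← Finset.sum_subset (Finset.subset_univ I), ← Finset.sum_coe_sort I] at h1
      · simpa [mul_comm] using h1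
      · intro k _ hk
        have : μ k = 0 := by simpa [I, supp] using hk
        simp [this])
  have htk' : ∀ i, ∑ k : I, (t k : ℝ) * (a k i : ℝ) = 0 := fun i => by
    have := htk i
    simp only [mul_comm (a _ i)] at this
    exact_mod_cast this
  have hpow : (((Fintype.card I * M) ^ (Fintype.card I - 1) : ℕ) : ℤ) ≤
      (((Fintype.card ι + 1) * M) ^ Fintype.card ι : ℕ) := by
    rw [Fintype.card_coe]
    norm_cast
    calc (I.card * M) ^ (I.card - 1) ≤ ((Fintype.card ι + 1) * M) ^ (I.card - 1) := by gcongr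
      _ ≤ _ := Nat.pow_le_pow_right (Nat.mul_pos (Nat.succ_pos _) hM) (by omega)
  have hfin : ∀ t : I → ℤ, t ≠ 0 → (∀ i, ∑ k : I, (t k : ℝ) * (a k i : ℝ) = 0) →
      (∀ k, |t k| ≤ ((Fintype.card I * M) ^ (Fintype.card I - 1) : ℕ)) →
      0 ≤ ∑ k : I, (t k : ℝ) * β k →
      ∃ (I : Finset κ) (μ : κ → ℤ), I.card ≤ Fintype.card ι + 1 ∧ (∀ k ∉ I, μ k = 0) ∧
      (∀ k, 0 ≤ μ k) ∧ (∀ k, μ k ≤ (((Fintype.card ι + 1) * M) ^ Fintype.card ι : ℕ)) ∧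
      (∀ i, ∑ k, μ k * a k i = 0) ∧ 0 < ∑ k, (μ k : ℝ) * β k := by
    intro t ht0 htk htb htβ
    let ν : κ → ℤ := fun k => if hk : k ∈ I then t ⟨k, hk⟩ else 0
    have hν : ∀ k, (ν k : ℝ) = if hk : k ∈ I then ((t ⟨k, hk⟩ : ℤ) : ℝ) else 0 := fun k => by
      simp only [ν]; split_ifs <;> simp
    have h1 : ∀ k, μ k = 0 → (ν k : ℝ) = 0 := fun k hk => by simp [hν, hoff k hk]
    have h2 : ∀ i, ∑ k, (ν k : ℝ) * (a k i : ℝ) = 0 := fun i => by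
      simp only [hν]
      rw [hsum (fun k => (a k i : ℝ)) fun k => (t k : ℝ)]
      exact htk i
    have h3 : ∑ k, (ν k : ℝ) * β k = ∑ k : I, (t k : ℝ) * β k := by
      simp only [hν]
      exact hsum β fun k => (t k : ℝ)
    refine ⟨I, ν, hcardI, fun k hk => by simp [ν, hk], fun k => ?_, fun k => ?_, fun i => ?_, ?_⟩
    · exact_mod_cast hnonneg (fun k => (ν k : ℝ)) h1 h2 (h3 ▸ htβ) k
    · by_cases hk : k ∈ I
      · simp only [ν, hk, dite_true]
        exact (le_abs_self _).trans ((htb _).trans hpow)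
      · simp only [ν, hk, dite_false]
        positivity
    · exact_mod_cast h2 i
    · refine lt_of_le_of_ne (h3 ▸ htβ) fun h0 => ht0 ?_
      have := hzero (fun k => (ν k : ℝ)) h1 h2 h0.symm
      funext k
      have hk := congrFun this k
      simpa [ν] using hk
  -- The small kernel vector `t` has no sign condition of its own: after choosing its sign,
  -- `hnonneg` makes it nonnegative and `hzero` makes its value strictly positive.
  rcases le_total 0 (∑ k : I, (t k : ℝ) * β k) with hβ | hβ
  · exact hfin t ht0 htk' htb hβ
  · exact hfin (-t) (neg_ne_zero.2 ht0) (fun i => by simpa using htk' i)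
      (fun k => by simpa using htb k) (by simpa using hβ)

/-! ### Vertices and their denominators. -/

/-- A feasible system of linear inequalities whose left-hand sides span has a vertex. -/
theorem exists_vertex {ι κ : Type*} [Fintype ι] [Fintype κ] [DecidableEq ι]
    (a : κ → ι → ℝ) (β : κ → ℝ)
    (hspan : ∀ v : ι → ℝ, (∀ k, ∑ i, a k i * v i = 0) → v = 0)
    (h : ∃ w : ι → ℝ, ∀ k, β k ≤ ∑ i, a k i * w i) :
    ∃ (w : ι → ℝ) (f : ι → κ), (∀ k, β k ≤ ∑ i, a k i * w i) ∧
      (∀ j, ∑ i, a (f j) i * w i = β (f j)) ∧ (Matrix.of fun j => a (f j)).det ≠ 0 := by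
  classical
  let tight : (ι → ℝ) → Finset κ := fun w => Finset.univ.filter fun k => ∑ i, a k i * w i = β k
  -- A feasible point with the most tight inequalities, found by minimizing the number of slack
  -- ones.
  obtain ⟨w, hw, hmax⟩ : ∃ w, (∀ k, β k ≤ ∑ i, a k i * w i) ∧
      ∀ w' : ι → ℝ, (∀ k, β k ≤ ∑ i, a k i * w' i) → (tight w').card ≤ (tight w).card := by
    have hne : {w : ι → ℝ | ∀ k, β k ≤ ∑ i, a k i * w i}.Nonempty := h
    have := Function.argminOn_mem (fun w => Fintype.card κ - (tight w).card) _ hne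
    refine ⟨_, this, fun w' hw' => ?_⟩
    have h1 := Function.argminOn_le (fun w => Fintype.card κ - (tight w).card)
      {w : ι → ℝ | ∀ k, β k ≤ ∑ i, a k i * w i} (a := w') hw'
    have h2 : (tight w').card ≤ Fintype.card κ := Finset.card_le_univ _
    have h3 := Finset.card_le_univ
      (tight (Function.argminOn (fun w => Fintype.card κ - (tight w).card) _ hne))
    omega
  -- A direction that preserves the tight inequalities and decreases another could be followed until
  -- a further one becomes tight. Applied to `v` and `-v`, this shows that the tight left-hand sides
  -- span.
  have hker : ∀ v : ι → ℝ, (∀ k ∈ tight w, ∑ i, a k i * v i = 0) → ∀ k, 0 ≤ ∑ i, a k i * v i := by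
    intro v hv
    by_contra! hneg
    obtain ⟨k₀, hk₀⟩ := hneg
    obtain ⟨k, hk, hkmin⟩ := Finset.exists_min_image
      (Finset.univ.filter fun k => ∑ i, a k i * v i < 0)
      (fun k => (∑ i, a k i * w i - β k) / (-∑ i, a k i * v i)) ⟨k₀, by simpa using hk₀⟩
    have hk' : ∑ i, a k i * v i < 0 := by simpa using hk
    set c := (∑ i, a k i * w i - β k) / (-∑ i, a k i * v i) with hc
    have hc0 : 0 ≤ c := div_nonneg (sub_nonneg.2 (hw k)) (by linarith)
    have hval : ∀ l, ∑ i, a l i * (w i + c * v i) = ∑ i, a l i * w i + c * ∑ i, a l i * v i := by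
      intro l
      rw [Finset.mul_sum, ← Finset.sum_add_distrib]
      exact Finset.sum_congr rfl fun i _ => by ring
    have hfeas : ∀ l, β l ≤ ∑ i, a l i * (w i + c * v i) := by
      intro l
      rw [hval]
      rcases lt_or_ge (∑ i, a l i * v i) 0 with hl | hl
      · have := hkmin l (by simpa using hl)
        rw [le_div_iff₀ (by linarith)] at this
        linarith
      · have := hw l
        have := mul_nonneg hc0 hl
        linarith
    have hlt : (tight w).card < (tight fun i => w i + c * v i).card := by
      refine Finset.card_lt_card (Finset.ssubset_iff_of_subset ?_ |>.2 ⟨k, ?_, ?_⟩)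
      · intro l hl
        have h0 := hv l hl
        simp only [tight, Finset.mem_filter, Finset.mem_univ, true_and] at hl ⊢
        rw [hval, h0, hl]
        ring
      · simp only [tight, Finset.mem_filter, Finset.mem_univ, true_and]
        rw [hval, hc]
        have := hk'.ne
        field_simp
        ring
      · exact fun hkt => hk'.ne (hv k hkt)
    exact absurd (hmax _ hfeas) (not_le.2 hlt)
  have hker0 : ∀ v : ι → ℝ, (∀ k ∈ tight w, ∑ i, a k i * v i = 0) → v = 0 := by
    intro v hv
    refine hspan v fun k => le_antisymm ?_ (hker v hv k)
    have := hker (-v) (fun l hl => by simp [hv l hl]) k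
    simpa using this
  obtain ⟨γ, f, hf, hsp, hli⟩ := exists_linearIndependent' ℝ fun k : tight w => a k
  have : Fintype γ := Fintype.ofInjective f hf
  have hcard : Fintype.card γ = Fintype.card ι := by
    refine le_antisymm ?_ ?_
    · simpa using hli.fintype_card_le_finrank
    · by_contra! hlt
      let φ : (ι → ℝ) →ₗ[ℝ] (γ → ℝ) := Matrix.mulVecLin (Matrix.of fun g i => a (f g) i)
      have hb : LinearMap.ker φ ≠ ⊥ := LinearMap.ker_ne_bot_of_finrank_lt (by simpa using hlt)
      obtain ⟨v, hv, hv0⟩ := (Submodule.ne_bot_iff _).1 hb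
      have hφ : φ v = 0 := hv
      refine hv0 (hker0 v fun k hk => ?_)
      have hmem : a k ∈ Submodule.span ℝ (Set.range ((fun k : tight w => a k) ∘ f)) :=
        hsp ▸ Submodule.subset_span ⟨⟨k, hk⟩, rfl⟩
      generalize a k = u at hmem ⊢
      induction hmem using Submodule.span_induction with
      | mem x hx =>
        obtain ⟨g, rfl⟩ := hx
        simpa [φ, Matrix.mulVec, dotProduct] using congrFun hφ g
      | zero => simp
      | add x y _ _ hx hy => simp [add_mul, Finset.sum_add_distrib, hx, hy]
      | smul c x _ hx => simp [mul_assoc, ← Finset.mul_sum, hx]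
  let e : ι ≃ γ := (Fintype.equivOfCardEq hcard).symm
  refine ⟨w, fun j => f (e j), hw, fun j => (Finset.mem_filter.1 (f (e j)).2).2, ?_⟩
  have hli' : LinearIndependent ℝ (Matrix.of fun j => a (f (e j))).row := hli.comp e e.injective
  rw [Matrix.linearIndependent_rows_iff_isUnit, Matrix.isUnit_iff_isUnit_det] at hli'
  exact hli'.ne_zero

/-- A vertex of an integral system: the denominators are bounded in terms of the left-hand sides
only. -/
theorem exists_integral_vertex {ι κ : Type*} [Fintype ι] [Fintype κ]
    (a : κ → ι → ℤ) {M : ℕ} (hM : 1 ≤ M) (ha : ∀ k i, |a k i| ≤ M) (β : κ → ℝ)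
    (hspan : ∀ v : ι → ℝ, (∀ k, ∑ i, (a k i : ℝ) * v i = 0) → v = 0)
    (h : ∃ w : ι → ℝ, ∀ k, β k ≤ ∑ i, (a k i : ℝ) * w i)
    {L : ℕ} (hL : ∀ k, ∃ z : ℤ, (L : ℝ) * β k = z) {X : ℝ} (hX : ∀ k, |β k| ≤ X) :
    ∃ w : ι → ℝ, (∀ k, β k ≤ ∑ i, (a k i : ℝ) * w i) ∧
      ∃ D : ℕ, 1 ≤ D ∧ D ≤ (Fintype.card ι).factorial * M ^ Fintype.card ι ∧
        (∀ i, ∃ z : ℤ, (D : ℝ) * L * w i = z) ∧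
        ∀ i, |w i| ≤ Fintype.card ι * ((Fintype.card ι).factorial * M ^ Fintype.card ι) * X := by
  classical
  obtain ⟨w, f, hw, htight, hdet⟩ := exists_vertex (fun k i => (a k i : ℝ)) β hspan h
  let B : Matrix ι ι ℤ := Matrix.of fun j => a (f j)
  have hBmap : (Matrix.of fun j i => (a (f j) i : ℝ)) = B.map (Int.castRingHom ℝ) := by
    ext; simp [B]
  have hdetB : B.det ≠ 0 := by
    intro h0
    apply hdet
    rw [hBmap, ← RingHom.mapMatrix_apply, ← RingHom.map_det, h0, map_zero]
  have hBw : ∀ j, ∑ i, (B j i : ℝ) * w i = β (f j) := htight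
  -- Cramer's rule: the adjugate is integral, so only `det B` and the denominators of `β` enter.
  have hadj : ∀ i, (B.det : ℝ) * w i = ∑ j, (B.adjugate i j : ℝ) * β (f j) := by
    intro i
    have hmul : ∀ l, ∑ j, (B.adjugate i j : ℝ) * (B j l : ℝ) = if i = l then (B.det : ℝ) else 0 := by
      intro l
      have := congrFun (congrFun (Matrix.adjugate_mul B) i) l
      rw [Matrix.mul_apply, Matrix.smul_apply, Matrix.one_apply] at this
      have h2 := congrArg (Int.cast : ℤ → ℝ) this
      push_cast at h2
      rw [h2]
      split_ifs <;> simp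
    calc (B.det : ℝ) * w i = ∑ l, (∑ j, (B.adjugate i j : ℝ) * (B j l : ℝ)) * w l := by
          simp [hmul]
      _ = ∑ j, (B.adjugate i j : ℝ) * ∑ l, (B j l : ℝ) * w l := by
          simp only [Finset.sum_mul, Finset.mul_sum]
          rw [Finset.sum_comm]
          exact Finset.sum_congr rfl fun j _ => Finset.sum_congr rfl fun l _ => by ring
      _ = _ := by simp only [hBw]
  have hdetle : ∀ B' : Matrix ι ι ℤ, (∀ i j, |B' i j| ≤ M) →
      |B'.det| ≤ ((Fintype.card ι).factorial * M ^ Fintype.card ι : ℕ) := by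
    intro B' hB'
    have := Matrix.det_le (A := B') (abv := AbsoluteValue.abs) (x := (M : ℤ)) hB'
    simpa using this
  have hadjle : ∀ i j, |B.adjugate i j| ≤ ((Fintype.card ι).factorial * M ^ Fintype.card ι : ℕ) := by
    intro i j
    rw [Matrix.adjugate_apply]
    refine hdetle _ fun k l => ?_
    rw [Matrix.updateRow_apply]
    split_ifs
    · rw [Pi.single_apply]
      split_ifs
      · simpa using hM
      · simp
    · exact ha _ _
  refine ⟨w, hw, B.det.natAbs, Int.natAbs_pos.2 hdetB, ?_, fun i => ?_, fun i => ?_⟩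
  · have := hdetle B fun j i => ha (f j) i
    rw [Int.abs_eq_natAbs] at this
    exact_mod_cast this
  · choose z hz using hL
    have h1 : (B.det : ℝ) * L * w i = ((∑ j, B.adjugate i j * z (f j) : ℤ) : ℝ) := by
      rw [mul_right_comm, hadj, Finset.sum_mul]
      push_cast
      exact Finset.sum_congr rfl fun j _ => by rw [← hz]; ring
    rcases Int.natAbs_eq B.det with h0 | h0
    · have h2 : (B.det : ℝ) = (B.det.natAbs : ℝ) := by
        rw [← Int.cast_natCast]; exact congrArg _ h0
      exact ⟨_, by rw [← h2, h1]⟩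
    · have h2 : (B.det : ℝ) = -(B.det.natAbs : ℝ) := by
        rw [← Int.cast_natCast, ← Int.cast_neg]; exact congrArg _ h0
      exact ⟨-_, by rw [Int.cast_neg, ← h1, h2]; ring⟩
  · have hone : (1 : ℝ) ≤ |(B.det : ℝ)| := by
      exact_mod_cast Int.one_le_abs hdetB
    calc |w i| ≤ |(B.det : ℝ)| * |w i| := le_mul_of_one_le_left (abs_nonneg _) hone
      _ = |∑ j, (B.adjugate i j : ℝ) * β (f j)| := by rw [← abs_mul, hadj]
      _ ≤ ∑ j, |(B.adjugate i j : ℝ) * β (f j)| := Finset.abs_sum_le_sum_abs _ _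
      _ ≤ ∑ _j : ι, (((Fintype.card ι).factorial * M ^ Fintype.card ι : ℕ) : ℝ) * X := by
          refine Finset.sum_le_sum fun j _ => ?_
          rw [abs_mul]
          have : |(B.adjugate i j : ℝ)| ≤ ((Fintype.card ι).factorial * M ^ Fintype.card ι : ℕ) := by
            exact_mod_cast hadjle i j
          exact mul_le_mul this (hX _) (abs_nonneg _) (by positivity)
      _ = _ := by simp; ring

/-! ### Approximate inequalities and the elimination of one block. -/

/-- The integral inequalities `g.2 ≤ g.1 ⬝ x` with entries bounded by `M` and supported in `S` whose
homogenization `g.2 * τ ≤ g.1 ⬝ y` is violated by at most `ε`. -/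
def approxForms {N : ℕ} (y : Fin N → ℝ) (τ : ℝ) (S : Finset (Fin N)) (M : ℕ) (ε : ℝ) :
    Set ((Fin N → ℤ) × ℤ) :=
  {g | (∀ i, |g.1 i| ≤ M) ∧ |g.2| ≤ M ∧ (∀ i ∉ S, g.1 i = 0) ∧
    (g.2 : ℝ) * τ - ε ≤ ∑ i, (g.1 i : ℝ) * y i}

/-- `x` satisfies all inequalities `g.2 ≤ g.1 ⬝ x` with `g ∈ G`. -/
def SatisfiesForms {N : ℕ} (x : Fin N → ℝ) (G : Set ((Fin N → ℤ) × ℤ)) : Prop :=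
  ∀ g ∈ G, (g.2 : ℝ) ≤ ∑ i, (g.1 i : ℝ) * x i

theorem approxForms_finite {N : ℕ} (y : Fin N → ℝ) (τ : ℝ) (S : Finset (Fin N)) (M : ℕ) (ε : ℝ) :
    (approxForms y τ S M ε).Finite := by
  refine ((Set.finite_Icc (fun _ : Fin N => -(M : ℤ)) fun _ => (M : ℤ)).prod
    (Set.finite_Icc (-(M : ℤ)) M)).subset fun g hg => ?_
  exact ⟨⟨fun i => (abs_le.1 (hg.1 i)).1, fun i => (abs_le.1 (hg.1 i)).2⟩, abs_le.1 hg.2.1⟩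

theorem approxForms_mono {N : ℕ} {y : Fin N → ℝ} {τ : ℝ} {S S' : Finset (Fin N)} {M M' : ℕ}
    {ε ε' : ℝ} (hS : S ⊆ S') (hM : M ≤ M') (hε : ε ≤ ε') :
    approxForms y τ S M ε ⊆ approxForms y τ S' M' ε' := fun g hg =>
  ⟨fun i => (hg.1 i).trans (by exact_mod_cast hM), hg.2.1.trans (by exact_mod_cast hM),
    fun i hi => hg.2.2.1 i fun h => hi (hS h), by linarith [hg.2.2.2]⟩

theorem sum_mul_eq_of_support {N : ℕ} {O S : Finset (Fin N)} (hO : O ⊆ S) (f : Fin N → ℤ)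
    (hf : ∀ i ∉ S, f i = 0) (v : Fin N → ℝ) :
    ∑ i, (f i : ℝ) * v i = ∑ i : O, (f i : ℝ) * v i + ∑ i ∈ S \ O, (f i : ℝ) * v i := by
  rw [Finset.sum_coe_sort O fun i => (f i : ℝ) * v i, add_comm, Finset.sum_sdiff hO]
  exact (Finset.sum_subset (Finset.subset_univ S) fun i _ hi => by simp [hf i hi]).symm

theorem abs_sum_mul_le_of_support {κ : Type*} [Fintype κ] (I : Finset κ) (μ : κ → ℤ)
    (hI : ∀ k ∉ I, μ k = 0) {n B : ℕ} (hn : I.card ≤ n) (h0 : ∀ k, 0 ≤ μ k) (hB : ∀ k, μ k ≤ B)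
    (c : κ → ℝ) {M : ℝ} (hM : 0 ≤ M) (hc : ∀ k, c k ≤ M) : ∑ k, (μ k : ℝ) * c k ≤ n * B * M := by
  rw [← Finset.sum_subset (Finset.subset_univ I) fun k _ hk => by simp [hI k hk]]
  calc ∑ k ∈ I, (μ k : ℝ) * c k ≤ ∑ _k ∈ I, (B : ℝ) * M := by
        refine Finset.sum_le_sum fun k _ => ?_
        have h1 : (0 : ℝ) ≤ μ k := by exact_mod_cast h0 k
        have h2 : (μ k : ℝ) ≤ B := by exact_mod_cast hB k
        calc (μ k : ℝ) * c k ≤ μ k * M := by gcongr; exact hc k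
          _ ≤ B * M := by gcongr
    _ = I.card * (B * M) := by simp
    _ ≤ n * (B * M) := by gcongr
    _ = n * B * M := by ring

/-- If `x` satisfies the inequalities on `S \ O` then its values on `O` can be chosen, with bounded
denominators, such that it satisfies the (smaller) inequalities on `S`. -/
theorem exists_extension_satisfiesForms {N : ℕ} {y : Fin N → ℝ} {τ : ℝ} {O S : Finset (Fin N)}
    (hO : O ⊆ S) {M M' : ℕ} (hM : 1 ≤ M) {ε ε' : ℝ} (hε : 0 ≤ ε)
    (hM' : (O.card + 1) * ((O.card + 1) * M) ^ O.card * M ≤ M')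
    (hε' : (((O.card + 1) * ((O.card + 1) * M) ^ O.card : ℕ) : ℝ) * ε ≤ ε')
    (hspan : ∀ i ∈ O, ∃ σ : ℤ, σ ≠ 0 ∧ ((Pi.single i σ, 0) : (Fin N → ℤ) × ℤ) ∈
      approxForms y τ S M ε)
    {x : Fin N → ℝ} (hx : SatisfiesForms x (approxForms y τ (S \ O) M' ε'))
    {L : ℕ} (hL : ∀ i ∈ S \ O, ∃ z : ℤ, (L : ℝ) * x i = z) {X : ℝ} (hX0 : 0 ≤ X)
    (hX : ∀ i ∈ S \ O, |x i| ≤ X) {D : ℕ} (hD : O.card.factorial * M ^ O.card ≤ D) :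
    ∃ w : Fin N → ℝ, (∀ i ∉ O, w i = x i) ∧ SatisfiesForms w (approxForms y τ S M ε) ∧
      (∀ i ∈ O, ∃ z : ℤ, (D.factorial : ℝ) * L * w i = z) ∧
      ∀ i ∈ O, |w i| ≤ O.card * D * (M + (S \ O).card * M * X) := by
  classical
  have : Fintype (approxForms y τ S M ε) := (approxForms_finite y τ S M ε).fintype
  let a : approxForms y τ S M ε → O → ℤ := fun g i => g.1.1 i
  let β : approxForms y τ S M ε → ℝ := fun g => g.1.2 - ∑ i ∈ S \ O, (g.1.1 i : ℝ) * x i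
  have ha : ∀ g i, |a g i| ≤ M := fun g i => g.2.1 i
  have hfeas : ∃ w : O → ℝ, ∀ g, β g ≤ ∑ i, (a g i : ℝ) * w i := by
    by_contra hinf
    obtain ⟨I, μ, hI, hμI, hμ0, hμB, hμk, hμpos⟩ := exists_bounded_farkas_certificate a hM ha β hinf
    rw [Fintype.card_coe] at hI hμB
    have hup : ∀ (c : approxForms y τ S M ε → ℝ) {B : ℝ}, 0 ≤ B → (∀ g, c g ≤ B) →
        ∑ g, (μ g : ℝ) * c g ≤ (((O.card + 1) * ((O.card + 1) * M) ^ O.card : ℕ) : ℝ) * B := by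
      intro c B hB hc
      have := abs_sum_mul_le_of_support I μ hμI hI hμ0 hμB c hB hc
      push_cast at this ⊢
      exact this
    have habs : ∀ c : approxForms y τ S M ε → ℤ, (∀ g, |c g| ≤ M) → |∑ g, μ g * c g| ≤ M' := by
      intro c hc
      have h1 := hup (fun g => (c g : ℝ)) (B := M) (by positivity)
        fun g => by exact_mod_cast (abs_le.1 (hc g)).2
      have h2 := hup (fun g => -(c g : ℝ)) (B := M) (by positivity) fun g => by
        have := (abs_le.1 (hc g)).1
        have : -(M : ℝ) ≤ c g := by exact_mod_cast this
        linarith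
      have h3 : (((O.card + 1) * ((O.card + 1) * M) ^ O.card : ℕ) : ℝ) * M ≤ M' := by
        exact_mod_cast hM'
      simp only [mul_neg, Finset.sum_neg_distrib] at h2
      have h4 := h1.trans h3
      have h5 := h2.trans h3
      rw [abs_le]
      constructor
      · have : -(M' : ℝ) ≤ ∑ g, (μ g : ℝ) * (c g : ℝ) := by linarith
        exact_mod_cast this
      · exact_mod_cast h4
    -- The combination of the inequalities given by the certificate. The variables in `O` cancel, so
    -- `F` is one of the inequalities that `x` satisfies on `S \ O`; this contradicts the
    -- certificate.
    let F : (Fin N → ℤ) × ℤ := (fun i => ∑ g, μ g * g.1.1 i, ∑ g, μ g * g.1.2)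
    have hswap : ∀ (T : Finset (Fin N)) (v : Fin N → ℝ),
        ∑ i ∈ T, (F.1 i : ℝ) * v i = ∑ g, (μ g : ℝ) * ∑ i ∈ T, (g.1.1 i : ℝ) * v i := by
      intro T v
      simp only [F, Int.cast_sum, Int.cast_mul, Finset.sum_mul, Finset.mul_sum]
      rw [Finset.sum_comm]
      exact Finset.sum_congr rfl fun g _ => Finset.sum_congr rfl fun i _ => by ring
    have hFv : ∀ i ∉ S \ O, F.1 i = 0 := by
      intro i hi
      by_cases hiO : i ∈ O
      · exact hμk ⟨i, hiO⟩
      · refine Finset.sum_eq_zero fun g _ => ?_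
        rw [g.2.2.2.1 i fun hiS => hi (Finset.mem_sdiff.2 ⟨hiS, hiO⟩), mul_zero]
    have hF2 : (F.2 : ℝ) = ∑ g, (μ g : ℝ) * (g.1.2 : ℝ) := by simp [F]
    have hF : F ∈ approxForms y τ (S \ O) M' ε' := by
      refine ⟨fun i => habs _ fun g => g.2.1 i, habs _ fun g => g.2.2.1, hFv, ?_⟩
      have h1 := hup (fun g => (g.1.2 : ℝ) * τ - ∑ i, (g.1.1 i : ℝ) * y i) hε fun g => by
        linarith [g.2.2.2.2]
      rw [hswap, hF2]
      simp only [mul_sub, Finset.sum_sub_distrib, ← mul_assoc, ← Finset.sum_mul] at h1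
      linarith
    have hFx := hx F hF
    have hsum : ∑ i, (F.1 i : ℝ) * x i = ∑ i ∈ S \ O, (F.1 i : ℝ) * x i :=
      (Finset.sum_subset (Finset.subset_univ _) fun i _ hi => by simp [hFv i hi]).symm
    rw [hsum, hswap, hF2] at hFx
    simp only [β, mul_sub, Finset.sum_sub_distrib] at hμpos
    linarith
  -- The inequalities of `hspan` bound each coordinate on one side, so the system contains no line
  -- and has a vertex.
  have hspan' : ∀ v : O → ℝ, (∀ g, ∑ i, (a g i : ℝ) * v i = 0) → v = 0 := by
    intro v hv
    funext i
    obtain ⟨σ, hσ0, hσ⟩ := hspan i i.2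
    have h1 := hv ⟨_, hσ⟩
    rw [Finset.sum_eq_single i (fun j _ hj => by
      have : (j : Fin N) ≠ i := fun h => hj (Subtype.ext h)
      simp [a, this]) (by simp)] at h1
    have : (σ : ℝ) * v i = 0 := by simpa [a] using h1
    exact (mul_eq_zero.1 this).resolve_left (by exact_mod_cast hσ0)
  have hLβ : ∀ g, ∃ z : ℤ, (L : ℝ) * β g = z := by
    intro g
    choose! z hz using hL
    refine ⟨L * g.1.2 - ∑ i ∈ S \ O, g.1.1 i * z i, ?_⟩
    simp only [β, mul_sub, Finset.mul_sum]
    push_cast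
    congr 1
    exact Finset.sum_congr rfl fun i hi => by rw [← hz i hi]; ring
  have hXβ : ∀ g, |β g| ≤ M + (S \ O).card * M * X := by
    intro g
    have hMabs : ∀ z : ℤ, |z| ≤ M → |(z : ℝ)| ≤ M := fun z hz => by exact_mod_cast hz
    refine (abs_sub _ _).trans (add_le_add (hMabs _ g.2.2.1) ?_)
    calc |∑ i ∈ S \ O, (g.1.1 i : ℝ) * x i| ≤ ∑ i ∈ S \ O, |(g.1.1 i : ℝ) * x i| :=
          Finset.abs_sum_le_sum_abs _ _
      _ ≤ ∑ _i ∈ S \ O, (M : ℝ) * X := Finset.sum_le_sum fun i hi => by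
          rw [abs_mul]
          exact mul_le_mul (hMabs _ (g.2.1 i)) (hX i hi) (abs_nonneg _) (by positivity)
      _ = _ := by simp [mul_assoc]
  obtain ⟨w, hw, E, hE1, hED, hEw, hwb⟩ := exists_integral_vertex a hM ha β hspan' hfeas hLβ hXβ
  rw [Fintype.card_coe] at hED hwb
  refine ⟨fun i => if hi : i ∈ O then w ⟨i, hi⟩ else x i, fun i hi => by simp [hi], fun g hg => ?_,
    fun i hi => ?_, fun i hi => ?_⟩
  · rw [sum_mul_eq_of_support hO g.1 hg.2.2.1]
    have h1 := hw ⟨g, hg⟩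
    have h2 : ∑ i ∈ S \ O, (g.1 i : ℝ) * (if hi : i ∈ O then w ⟨i, hi⟩ else x i)
        = ∑ i ∈ S \ O, (g.1 i : ℝ) * x i :=
      Finset.sum_congr rfl fun i hi => by simp [(Finset.mem_sdiff.1 hi).2]
    rw [h2]
    simp only [β, a] at h1
    simpa [add_comm, sub_le_iff_le_add] using h1
  · obtain ⟨z, hz⟩ := hEw ⟨i, hi⟩
    -- The determinant `E` depends on the chosen vertex; passing to `D!` gives a multiple that does
    -- not.
    obtain ⟨c, hc⟩ := Nat.dvd_factorial hE1 (hED.trans hD)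
    refine ⟨c * z, ?_⟩
    simp only [hi, dite_true]
    rw [hc]
    push_cast
    rw [← hz]
    ring
  · simp only [hi, dite_true]
    refine (hwb ⟨i, hi⟩).trans ?_
    have : ((O.card.factorial * M ^ O.card : ℕ) : ℝ) ≤ D := by exact_mod_cast hD
    push_cast at this
    gcongr

theorem SatisfiesForms.congr {N : ℕ} {y : Fin N → ℝ} {τ : ℝ} {S : Finset (Fin N)} {M : ℕ} {ε : ℝ}
    {x x' : Fin N → ℝ} (hx : SatisfiesForms x (approxForms y τ S M ε)) (h : ∀ i ∈ S, x' i = x i) :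
    SatisfiesForms x' (approxForms y τ S M ε) := by
  intro g hg
  refine (hx g hg).trans_eq (Finset.sum_congr rfl fun i _ => ?_)
  by_cases hi : i ∈ S
  · rw [h i hi]
  · simp [hg.2.2.1 i hi]

/-! ### Root paths of the multistage tree. -/

namespace MultistageTree

variable {m N : ℕ} {A : Matrix (Fin m) (Fin N) ℤ} {B : BlockDecomposition A} (T : MultistageTree B)

/-- The columns of the block `k`. -/
def ownColumns (_T : MultistageTree B) (k : Fin B.ℓ) : Finset (Fin N) :=
  Finset.univ.filter fun j => B.block j = k

open Classical in
/-- The columns of the blocks on the path from the root to `k`. -/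
noncomputable def pathColumns (k : Fin B.ℓ) : Finset (Fin N) :=
  Finset.univ.filter fun j =>
    ∃ n, T.parent^[n] k = B.block j ∧ n + T.height (B.block j) = T.height k

theorem mem_ownColumns {k : Fin B.ℓ} {j : Fin N} : j ∈ T.ownColumns k ↔ B.block j = k := by
  simp [ownColumns]

/-- The equation of heights excludes iterates that run past the root, where the value of `parent` is
unconstrained. -/
theorem mem_pathColumns {k : Fin B.ℓ} {j : Fin N} : j ∈ T.pathColumns k ↔
    ∃ n, T.parent^[n] k = B.block j ∧ n + T.height (B.block j) = T.height k := by
  simp [pathColumns]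

theorem ownColumns_subset_pathColumns (k : Fin B.ℓ) : T.ownColumns k ⊆ T.pathColumns k := by
  intro j hj
  rw [mem_ownColumns] at hj
  exact T.mem_pathColumns.2 ⟨0, by simp [hj]⟩

theorem height_block_le {k : Fin B.ℓ} {j : Fin N} (hj : j ∈ T.pathColumns k) :
    T.height (B.block j) ≤ T.height k := by
  obtain ⟨n, -, h⟩ := T.mem_pathColumns.1 hj
  omega

theorem height_block_lt {k : Fin B.ℓ} {j : Fin N} (hj : j ∈ T.pathColumns k \ T.ownColumns k) :
    T.height (B.block j) < T.height k := by
  obtain ⟨hj, hj'⟩ := Finset.mem_sdiff.1 hj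
  obtain ⟨n, hn, h⟩ := T.mem_pathColumns.1 hj
  rcases n with _ | n
  · exact absurd (T.mem_ownColumns.2 hn.symm) hj'
  · omega

theorem pathColumns_sdiff_root : T.pathColumns T.root \ T.ownColumns T.root = ∅ := by
  refine Finset.eq_empty_of_forall_notMem fun j hj => ?_
  have := T.height_block_lt hj
  rw [(T.height_eq_zero_iff T.root).2 rfl] at this
  omega

theorem pathColumns_sdiff {k : Fin B.ℓ} (hk : k ≠ T.root) :
    T.pathColumns k \ T.ownColumns k = T.pathColumns (T.parent k) := by
  ext j
  have hh := T.height_parent k hk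
  constructor
  · intro hj
    obtain ⟨hj, hj'⟩ := Finset.mem_sdiff.1 hj
    obtain ⟨n, hn, h⟩ := T.mem_pathColumns.1 hj
    rcases n with _ | n
    · exact absurd (T.mem_ownColumns.2 hn.symm) hj'
    · exact T.mem_pathColumns.2 ⟨n, by rw [← Function.iterate_succ_apply, hn], by omega⟩
  · intro hj
    obtain ⟨n, hn, h⟩ := T.mem_pathColumns.1 hj
    refine Finset.mem_sdiff.2
      ⟨T.mem_pathColumns.2 ⟨n + 1, by rw [Function.iterate_succ_apply, hn], by omega⟩, fun h' => ?_⟩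
    rw [mem_ownColumns] at h'
    rw [h'] at h
    omega

theorem card_pathColumns (n : ℕ) : ∀ k : Fin B.ℓ, T.height k = n →
    (T.pathColumns k).card = ∑ i ∈ Finset.range (n + 1), T.s i := by
  induction n with
  | zero =>
    intro k hk
    have hr := (T.height_eq_zero_iff k).1 hk
    have h1 := Finset.card_sdiff_add_card_eq_card (T.ownColumns_subset_pathColumns k)
    rw [← h1, hr, pathColumns_sdiff_root]
    have := T.card_columns T.root
    rw [(T.height_eq_zero_iff T.root).2 rfl] at this
    simpa [ownColumns] using this
  | succ n ih =>
    intro k hk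
    have hr : k ≠ T.root := fun h => by
      rw [(T.height_eq_zero_iff k).2 h] at hk
      omega
    have hh := T.height_parent k hr
    have h1 := Finset.card_sdiff_add_card_eq_card (T.ownColumns_subset_pathColumns k)
    rw [← h1, T.pathColumns_sdiff hr, ih _ (by omega), Finset.sum_range_succ _ (n + 1), ← hk,
      ← T.card_columns k]
    rfl

theorem card_pathColumns_le (k : Fin B.ℓ) : (T.pathColumns k).card ≤ T.d := by
  rw [T.card_pathColumns _ k rfl]
  refine Finset.sum_le_sum_of_subset fun i hi => ?_
  have := T.height_le k
  simp only [Finset.mem_range] at hi ⊢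
  omega

theorem exists_iterate_parent {i : Fin m} : ∀ (n : ℕ) (k : Fin B.ℓ), n ≤ T.height k →
    i ∈ B.rows k → i ∈ B.rows (T.parent^[n] k) ∧ T.height (T.parent^[n] k) + n = T.height k := by
  intro n
  induction n with
  | zero => intro k _ hi; exact ⟨hi, rfl⟩
  | succ n ih =>
    intro k hn hi
    have hr : k ≠ T.root := fun h => by
      rw [(T.height_eq_zero_iff k).2 h] at hn
      omega
    have hh := T.height_parent k hr
    obtain ⟨h1, h2⟩ := ih (T.parent k) (by omega) (T.rows_subset_parent k hr hi)
    rw [Function.iterate_succ_apply]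
    exact ⟨h1, by omega⟩

/-- Take the deepest block `k` containing row `i`. Any block with a nonzero entry in this row
contains row `i`, as does the ancestor of `k` at the same height; disjointness makes the two equal.
-/
theorem exists_row_support (i : Fin m) : ∃ k, ∀ j, A i j ≠ 0 → j ∈ T.pathColumns k := by
  by_cases h : ∃ k, i ∈ B.rows k
  · obtain ⟨k₀, hk₀⟩ := h
    obtain ⟨k, hk, hmax⟩ := Finset.exists_max_image (Finset.univ.filter fun k => i ∈ B.rows k)
      T.height ⟨k₀, by simpa using hk₀⟩
    have hk : i ∈ B.rows k := by simpa using hk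
    refine ⟨k, fun j hj => ?_⟩
    have hij := B.support i j hj
    have hle := hmax (B.block j) (by simpa using hij)
    obtain ⟨h1, h2⟩ := T.exists_iterate_parent (T.height k - T.height (B.block j)) k (by omega) hk
    refine T.mem_pathColumns.2 ⟨T.height k - T.height (B.block j), ?_, by omega⟩
    by_contra hne
    exact Finset.disjoint_left.1 (T.disjoint_rows _ _ (by omega) hne) h1 hij
  · exact ⟨T.root, fun j hj => absurd ⟨_, B.support i j hj⟩ h⟩

/-! ### Elimination along the whole tree. -/

/-- Fourier–Motzkin elimination along the tree, followed by back substitution from the root. -/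
theorem exists_satisfiesForms {y : Fin N → ℝ} {τ : ℝ} {M : ℕ → ℕ} {ε : ℕ → ℝ} {D G : ℕ}
    (hM : ∀ n, 1 ≤ M n) (hε : ∀ n, 0 ≤ ε n)
    (hMstep : ∀ n < T.t, (T.d + 1) * ((T.d + 1) * M (n + 1)) ^ T.d * M (n + 1) ≤ M n)
    (hεstep : ∀ n < T.t,
      (((T.d + 1) * ((T.d + 1) * M (n + 1)) ^ T.d : ℕ) : ℝ) * ε (n + 1) ≤ ε n)
    (hτ : (((T.d + 1) * ((T.d + 1) * M 0) ^ T.d : ℕ) : ℝ) * ε 0 < τ)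
    (hD : ∀ n ≤ T.t, T.d.factorial * M n ^ T.d ≤ D)
    (hG1 : 1 ≤ G) (hG : ∀ n ≤ T.t, T.d * D * (M n + T.d * M n) ≤ G)
    (hspan : ∀ i, ∃ σ : ℤ, σ ≠ 0 ∧ ((Pi.single i σ, 0) : (Fin N → ℤ) × ℤ) ∈
      approxForms y τ (T.pathColumns (B.block i)) (M (T.height (B.block i)))
        (ε (T.height (B.block i)))) :
    ∃ x : Fin N → ℝ,
      (∀ k, SatisfiesForms x (approxForms y τ (T.pathColumns k) (M (T.height k))
        (ε (T.height k)))) ∧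
      ∀ i, (∃ z : ℤ, ((D.factorial ^ (T.t + 1) : ℕ) : ℝ) * x i = z) ∧ |x i| ≤ (G : ℝ) ^ (T.t + 1) := by
  suffices H : ∀ n ≤ T.t + 1, ∃ x : Fin N → ℝ,
      (∀ k, T.height k < n → SatisfiesForms x (approxForms y τ (T.pathColumns k) (M (T.height k))
        (ε (T.height k)))) ∧
      ∀ i, T.height (B.block i) < n →
        (∃ z : ℤ, ((D.factorial ^ n : ℕ) : ℝ) * x i = z) ∧ |x i| ≤ (G : ℝ) ^ n by
    obtain ⟨x, h1, h2⟩ := H (T.t + 1) le_rfl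
    exact ⟨x, fun k => h1 k (Nat.lt_succ_of_le (T.height_le k)),
      fun i => h2 i (Nat.lt_succ_of_le (T.height_le _))⟩
  intro n
  induction n with
  | zero => intro _; exact ⟨0, fun k hk => by omega, fun i hi => by omega⟩
  | succ n ih =>
    intro hn
    obtain ⟨x, hx, hxi⟩ := ih (by omega)
    have hown : ∀ k, (T.ownColumns k).card ≤ T.d := fun k =>
      (Finset.card_le_card (T.ownColumns_subset_pathColumns k)).trans (T.card_pathColumns_le k)
    have hmono : ∀ (k : Fin B.ℓ) (M : ℕ), 1 ≤ M →
        ((T.ownColumns k).card + 1) * (((T.ownColumns k).card + 1) * M) ^ (T.ownColumns k).card ≤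
          (T.d + 1) * ((T.d + 1) * M) ^ T.d := by
      intro k M hM
      have := hown k
      calc _ ≤ (T.d + 1) * ((T.d + 1) * M) ^ (T.ownColumns k).card := by gcongr
        _ ≤ _ := Nat.mul_le_mul_left _ (Nat.pow_le_pow_right (Nat.mul_pos (Nat.succ_pos _) hM) this)
    have hstep : ∀ k, T.height k = n → ∃ w : Fin N → ℝ, (∀ i ∉ T.ownColumns k, w i = x i) ∧
        SatisfiesForms w (approxForms y τ (T.pathColumns k) (M n) (ε n)) ∧
        (∀ i ∈ T.ownColumns k, ∃ z : ℤ, (D.factorial : ℝ) * (D.factorial ^ n : ℕ) * w i = z) ∧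
        ∀ i ∈ T.ownColumns k, |w i| ≤ (T.ownColumns k).card * D *
          (M n + (T.pathColumns k \ T.ownColumns k).card * M n * (G : ℝ) ^ n) := by
      intro k hk
      have hDk : (T.ownColumns k).card.factorial * M n ^ (T.ownColumns k).card ≤ D :=
        (Nat.mul_le_mul (Nat.factorial_le (hown k)) (Nat.pow_le_pow_right (hM n) (hown k))).trans
          (hD n (by omega))
      refine exists_extension_satisfiesForms (T.ownColumns_subset_pathColumns k) (hM n) (hε n)
        (M' := (T.d + 1) * ((T.d + 1) * M n) ^ T.d * M n)
        (ε' := (((T.d + 1) * ((T.d + 1) * M n) ^ T.d : ℕ) : ℝ) * ε n)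
        (Nat.mul_le_mul_right _ (hmono k _ (hM n))) ?_ (fun i hi => ?_) ?_
        (fun i hi => (hxi i (hk ▸ T.height_block_lt hi)).1) (by positivity)
        (fun i hi => (hxi i (hk ▸ T.height_block_lt hi)).2) hDk
      · refine mul_le_mul_of_nonneg_right ?_ (hε n)
        exact_mod_cast hmono k _ (hM n)
      · rw [mem_ownColumns] at hi
        have := hspan i
        rwa [hi, hk] at this
      -- At the root no variables remain, and an eliminated inequality reads `r ≤ 0`; an integer `r
      -- ≥ 1` would force `τ` below the accumulated error, against `hτ`. Below the root, the
      -- eliminated inequalities are already in the parent's list.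
      · by_cases hr : k = T.root
        · have hn0 : n = 0 := by rw [← hk]; exact (T.height_eq_zero_iff k).2 hr
          subst hn0
          intro g hg
          rw [hr, pathColumns_sdiff_root] at hg
          have hg0 : ∀ i, g.1 i = 0 := fun i => hg.2.2.1 i (by simp)
          have h1 := hg.2.2.2
          simp only [hg0, Int.cast_zero, zero_mul, Finset.sum_const_zero] at h1 ⊢
          by_contra! hpos
          have h2 : (1 : ℝ) ≤ g.2 := by exact_mod_cast (show 0 < g.2 by exact_mod_cast hpos)
          have h3 : 0 ≤ (((T.d + 1) * ((T.d + 1) * M 0) ^ T.d : ℕ) : ℝ) * ε 0 :=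
            mul_nonneg (by positivity) (hε 0)
          nlinarith
        · have hh := T.height_parent k hr
          obtain ⟨n', rfl⟩ : ∃ n', n = n' + 1 := ⟨T.height (T.parent k), by omega⟩
          have hp : T.height (T.parent k) = n' := by omega
          have h1 := hx (T.parent k) (by omega)
          rw [T.pathColumns_sdiff hr]
          rw [hp] at h1
          exact fun g hg => h1 g (approxForms_mono (Finset.Subset.refl _) (hMstep n' (by omega))
            (hεstep n' (by omega)) hg)
    choose! w hw1 hw2 hw3 hw4 using hstep
    -- The extensions at different blocks of height `n` do not interfere: each column has one block,
    -- and a root path meets height `n` at most once.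
    let x' : Fin N → ℝ := fun i => if T.height (B.block i) = n then w (B.block i) i else x i
    have hx'_lt : ∀ i, T.height (B.block i) < n → x' i = x i := fun i hi => by
      simp [x', hi.ne]
    refine ⟨x', fun k hk => ?_, fun i hi => ?_⟩
    · rcases Nat.lt_succ_iff_lt_or_eq.1 hk with hk | hk
      · exact (hx k hk).congr fun i hi => hx'_lt i ((T.height_block_le hi).trans_lt hk)
      · rw [hk]
        refine (hw2 k hk).congr fun i hi => ?_
        by_cases hik : i ∈ T.ownColumns k
        · have := T.mem_ownColumns.1 hik
          simp [x', this, hk]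
        · have := T.height_block_lt (Finset.mem_sdiff.2 ⟨hi, hik⟩)
          rw [hx'_lt i (hk ▸ this), hw1 k hk i hik]
    · rcases Nat.lt_succ_iff_lt_or_eq.1 hi with hi | hi
      · rw [hx'_lt i hi]
        obtain ⟨⟨z, hz⟩, hb⟩ := hxi i hi
        refine ⟨⟨D.factorial * z, ?_⟩, hb.trans ?_⟩
        · push_cast at hz ⊢
          rw [← hz]
          ring
        · exact pow_le_pow_right₀ (by exact_mod_cast hG1) (Nat.le_succ n)
      · have hown' : i ∈ T.ownColumns (B.block i) := T.mem_ownColumns.2 rfl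
        have e : x' i = w (B.block i) i := by simp [x', hi]
        rw [e]
        obtain ⟨z, hz⟩ := hw3 _ hi i hown'
        refine ⟨⟨z, ?_⟩, (hw4 _ hi i hown').trans ?_⟩
        · rw [← hz, pow_succ]
          push_cast
          ring
        · have h1 : ((T.ownColumns (B.block i)).card : ℝ) ≤ T.d := by exact_mod_cast hown _
          have h2 : ((T.pathColumns (B.block i) \ T.ownColumns (B.block i)).card : ℝ) ≤ T.d := by
            exact_mod_cast (Finset.card_le_card Finset.sdiff_subset).trans (T.card_pathColumns_le _)
          have h3 : (1 : ℝ) ≤ (G : ℝ) ^ n := one_le_pow₀ (by exact_mod_cast hG1)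
          have h4 : (T.d : ℝ) * D * (M n + T.d * M n) ≤ G := by exact_mod_cast hG n (by omega)
          calc _ ≤ (T.d : ℝ) * D * (M n * (G : ℝ) ^ n + T.d * M n * (G : ℝ) ^ n) := by
                gcongr
                exact le_mul_of_one_le_right (by positivity) h3
            _ = (T.d : ℝ) * D * (M n + T.d * M n) * (G : ℝ) ^ n := by ring
            _ ≤ G * (G : ℝ) ^ n := by gcongr
            _ = (G : ℝ) ^ (n + 1) := by ring

end MultistageTree

/-! ### Conformal integral kernel vectors. -/

theorem exists_sign_mul_eq_abs (a : ℝ) : ∃ σ : ℤ, |σ| = 1 ∧ (σ : ℝ) * a = |a| := by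
  rcases le_total 0 a with h | h
  · exact ⟨1, by simp, by simp [abs_of_nonneg h]⟩
  · exact ⟨-1, by simp, by simp [abs_of_nonpos h]⟩

theorem single_mem_approxForms {N : ℕ} {y : Fin N → ℝ} {τ : ℝ} {S : Finset (Fin N)} {M : ℕ} {ε : ℝ}
    (hM : 1 ≤ M) {i : Fin N} (hi : i ∈ S) {σ r : ℤ} (hσ : |σ| ≤ 1) (hr : |r| ≤ 1)
    (h : (r : ℝ) * τ - ε ≤ σ * y i) :
    ((Pi.single i σ, r) : (Fin N → ℤ) × ℤ) ∈ approxForms y τ S M ε := by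
  have hM' : (1 : ℤ) ≤ M := by exact_mod_cast hM
  refine ⟨fun l => ?_, hr.trans hM', fun l hl => ?_, ?_⟩
  · by_cases hl : l = i
    · subst hl; simpa using hσ.trans hM'
    · simp [hl]
  · have : l ≠ i := fun h => hl (h ▸ hi)
    simp [this]
  · have : ∑ l, ((Pi.single i σ : Fin N → ℤ) l : ℝ) * y l = σ * y i := by
      rw [Finset.sum_eq_single i (fun l _ hl => by simp [hl]) (by simp)]
      simp
    simpa only [this] using h

theorem SatisfiesForms.single {N : ℕ} {x : Fin N → ℝ} {G : Set ((Fin N → ℤ) × ℤ)}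
    (hx : SatisfiesForms x G) {i : Fin N} {σ r : ℤ} (h : (Pi.single i σ, r) ∈ G) :
    (r : ℝ) ≤ σ * x i := by
  have h1 := hx _ h
  simp only at h1
  rw [Finset.sum_eq_single i (fun l _ hl => by simp [hl]) (by simp)] at h1
  simpa using h1

/-- A real kernel vector with a large entry dominates a nonzero integral kernel vector. -/
theorem MultistageTree.exists_conformal_kernel_vector {m N : ℕ} {A : Matrix (Fin m) (Fin N) ℤ}
    {B : BlockDecomposition A} (T : MultistageTree B) {M : ℕ → ℕ} {D E G : ℕ}
    (hM : ∀ n, 1 ≤ M n) (hA : ∀ n i j, |A i j| ≤ M n)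
    (hMstep : ∀ n < T.t, (T.d + 1) * ((T.d + 1) * M (n + 1)) ^ T.d * M (n + 1) ≤ M n)
    (hE : ∀ n ≤ T.t, (T.d + 1) * ((T.d + 1) * M n) ^ T.d ≤ E)
    (hD : ∀ n ≤ T.t, T.d.factorial * M n ^ T.d ≤ D)
    (hG1 : 1 ≤ G) (hG : ∀ n ≤ T.t, T.d * D * (M n + T.d * M n) ≤ G)
    {y : Fin N → ℝ} (hy : ∀ i, ∑ j, (A i j : ℝ) * y j = 0) {j : Fin N}
    (hj : ((E ^ (T.t + 1) * (D.factorial ^ (T.t + 1) * G ^ (T.t + 1)) : ℕ) : ℝ) < |y j|) :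
    ∃ u : Fin N → ℤ, u ≠ 0 ∧ (∀ i, ∑ j, A i j * u j = 0) ∧
      ∀ i, 0 ≤ (u i : ℝ) * y i ∧ |(u i : ℝ)| ≤ |y i| := by
  set L := D.factorial ^ (T.t + 1) with hLdef
  set θ : ℝ := ((L * G ^ (T.t + 1) : ℕ) : ℝ) with hθ
  have hθ0 : 0 ≤ θ := Nat.cast_nonneg _
  have hL0 : 0 < L := pow_pos (Nat.factorial_pos _) _
  have hE1 : (1 : ℝ) ≤ E := by
    have : 1 ≤ E := le_trans (Nat.mul_pos (Nat.succ_pos _)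
      (pow_pos (Nat.mul_pos (Nat.succ_pos _) (hM 0)) _)) (hE 0 (Nat.zero_le _))
    exact_mod_cast this
  -- The error is `θ` at the leaves and grows by the factor `E` per level towards the root; one more
  -- factor at the root accounts for the threshold `E ^ (t + 1) * θ` on `|y j|`.
  let ε : ℕ → ℝ := fun n => (E : ℝ) ^ (T.t - n) * θ
  have hε0 : ∀ n, 0 ≤ ε n := fun n => by positivity
  have hθε : ∀ n, θ ≤ ε n := fun n => le_mul_of_one_le_left hθ0 (one_le_pow₀ hE1)
  choose σ hσ1 hσ using fun i => exists_sign_mul_eq_abs (y i)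
  have hpath : ∀ i, i ∈ T.pathColumns (B.block i) := fun i =>
    T.ownColumns_subset_pathColumns _ (T.mem_ownColumns.2 rfl)
  have hpos : ∀ i, ((Pi.single i (σ i), 0) : (Fin N → ℤ) × ℤ) ∈
      approxForms y |y j| (T.pathColumns (B.block i)) (M (T.height (B.block i)))
        (ε (T.height (B.block i))) := fun i =>
    single_mem_approxForms (hM _) (hpath i) (hσ1 i).le (by simp) (by
      rw [hσ]
      have := hε0 (T.height (B.block i))
      have := abs_nonneg (y i)
      push_cast
      linarith)
  obtain ⟨x, hx, hxi⟩ := T.exists_satisfiesForms (y := y) (τ := |y j|) (ε := ε) hM hε0 hMstep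
    (fun n hn => by
      have h1 : ε n = E * ε (n + 1) := by
        simp only [ε]
        rw [show T.t - n = (T.t - (n + 1)) + 1 by omega, pow_succ]
        ring
      rw [h1]
      exact mul_le_mul_of_nonneg_right (by exact_mod_cast hE (n + 1) hn) (hε0 _))
    (by
      refine lt_of_le_of_lt ?_ hj
      calc _ ≤ (E : ℝ) * ε 0 :=
            mul_le_mul_of_nonneg_right (by exact_mod_cast hE 0 (Nat.zero_le _)) (hε0 _)
        _ = _ := by
            simp only [ε, hθ, Nat.sub_zero]
            push_cast
            ring)
    hD hG1 hG (fun i => ⟨σ i, fun h => by simpa [h] using hσ1 i, hpos i⟩)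
  have hsign : ∀ i, 0 ≤ (σ i : ℝ) * x i := fun i => by simpa using (hx _).single (hpos i)
  choose z hz using fun i => (hxi i).1
  have hLR : (0 : ℝ) < L := by exact_mod_cast hL0
  have habsσ : ∀ i, |(σ i : ℝ)| = 1 := fun i => by exact_mod_cast hσ1 i
  have hsq : ∀ i, (σ i : ℝ) * σ i = 1 := fun i => by
    rw [← abs_mul_abs_self, habsσ, one_mul]
  refine ⟨z, fun h0 => ?_, fun i => ?_, fun i => ?_⟩
  -- With `τ = |y j|`, the inequality `1 ≤ σ j * x j` holds exactly for `y / τ`, which keeps `x`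
  -- away from zero.
  · have h1 := (hx _).single (single_mem_approxForms (r := 1) (hM _) (hpath j) (hσ1 j).le (by simp)
      (by
        rw [hσ]
        have := hε0 (T.height (B.block j))
        push_cast
        linarith))
    have h2 := hz j
    rw [h0] at h2
    have h3 : x j = 0 := by
      have : (L : ℝ) * x j = 0 := h2.trans (by simp)
      exact (mul_eq_zero.1 this).resolve_left hLR.ne'
    rw [h3] at h1
    norm_num at h1
  · obtain ⟨k, hk⟩ := T.exists_row_support i
    -- Row `i` and its negative are both in the list of `k`, because `y` satisfies them exactly.
    have hε := hε0 (T.height k)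
    have h1 := hx k (fun l => A i l, 0) ⟨fun l => hA _ i l, by simp,
      fun l hl => by_contra fun h => hl (hk l h), by
        simp only [hy i]
        push_cast
        linarith⟩
    have h2 := hx k (fun l => -A i l, 0) ⟨fun l => by simpa using hA _ i l, by simp,
      fun l hl => neg_eq_zero.2 (by_contra fun h => hl (hk l h)), by
        simp only [Int.cast_neg, neg_mul, Finset.sum_neg_distrib, hy i]
        push_cast
        linarith⟩
    simp only [Int.cast_neg, neg_mul, Finset.sum_neg_distrib, Int.cast_zero] at h1 h2
    have h3 : ∑ l, (A i l : ℝ) * x l = 0 := by linarith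
    have h4 : ∑ l, (A i l : ℝ) * (z l : ℝ) = 0 := by
      calc ∑ l, (A i l : ℝ) * (z l : ℝ) = L * ∑ l, (A i l : ℝ) * x l := by
            rw [Finset.mul_sum]
            exact Finset.sum_congr rfl fun l _ => by rw [← hz]; ring
        _ = 0 := by rw [h3, mul_zero]
    exact_mod_cast h4
  · have hyi : y i = σ i * |y i| := by rw [← hσ, ← mul_assoc, hsq, one_mul]
    refine ⟨?_, ?_⟩
    · have : (z i : ℝ) * y i = L * (σ i * x i) * |y i| := by
        rw [← hz]
        conv_lhs => rw [hyi]
        ring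
      rw [this]
      have := hsign i
      positivity
    -- If `|y i| ≥ θ`, the size bound on `L * x i` suffices. Otherwise `-σ i * x i ≥ 0` is violated
    -- by `y` by less than `θ`, so it is in the list and forces `x i = 0`.
    · rcases le_or_gt θ |y i| with h | h
      · refine le_trans ?_ h
        rw [← hz, abs_mul, abs_of_pos hLR, hθ]
        push_cast
        have := (hxi i).2
        gcongr
      · have h1 := (hx _).single (single_mem_approxForms (σ := -σ i) (r := 0) (hM _) (hpath i)
          (by simpa using (hσ1 i).le) (by simp) (by
            push_cast
            rw [neg_mul, hσ]
            have := hθε (T.height (B.block i))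
            linarith))
        push_cast at h1
        have h2 : (σ i : ℝ) * x i = 0 := le_antisymm (by linarith) (hsign i)
        have h3 : x i = 0 := by
          rw [← one_mul (x i), ← hsq i, mul_assoc, h2, mul_zero]
        rw [← hz, h3]
        simp

/-- Since `y j ≠ 0`, column `j` must vanish, so a signed unit vector works. This covers the
degenerate cases `d ≤ 1` and `Δ = 0`, where the numerical estimates fail. -/
theorem exists_conformal_kernel_vector_of_row_subsingleton {m N : ℕ}
    {A : Matrix (Fin m) (Fin N) ℤ} (hA : ∀ i j j', A i j ≠ 0 → A i j' ≠ 0 → j = j')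
    {y : Fin N → ℝ} (hy : ∀ i, ∑ j, (A i j : ℝ) * y j = 0) {j : Fin N} (hj : 1 < |y j|) :
    ∃ u : Fin N → ℤ, u ≠ 0 ∧ (∀ i, ∑ j, A i j * u j = 0) ∧
      ∀ i, 0 ≤ (u i : ℝ) * y i ∧ |(u i : ℝ)| ≤ |y i| := by
  obtain ⟨σ, hσ1, hσ⟩ := exists_sign_mul_eq_abs (y j)
  refine ⟨Pi.single j σ, fun h => ?_, fun i => ?_, fun i => ?_⟩
  · have := congrFun h j
    rw [Pi.single_eq_same, Pi.zero_apply] at this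
    simp [this] at hσ1
  · have h0 : A i j = 0 := by
      by_contra hne
      have h1 := hy i
      rw [Finset.sum_eq_single j (fun l _ hl => by
        have : A i l = 0 := by_contra fun h => hl (hA i l j h hne)
        simp [this]) (by simp)] at h1
      rcases mul_eq_zero.1 h1 with h2 | h2
      · exact hne (by exact_mod_cast h2)
      · rw [h2] at hj
        norm_num at hj
    rw [Finset.sum_eq_single j (fun l _ hl => by simp [hl]) (by simp), h0, zero_mul]
  · by_cases hi : i = j
    · subst hi
      have : |(σ : ℝ)| = 1 := by exact_mod_cast hσ1
      simp only [Pi.single_eq_same, hσ, this]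
      exact ⟨abs_nonneg _, hj.le⟩
    · simp [hi]

/-! ### Choice of the constants. -/

theorem abs_le_maxAbsEntry {m N : ℕ} (A : Matrix (Fin m) (Fin N) ℤ) (i : Fin m) (j : Fin N) :
    |A i j| ≤ maxAbsEntry A := by
  rw [Int.abs_eq_natAbs]
  have h1 := Finset.le_sup (f := fun j => (A i j).natAbs) (Finset.mem_univ j)
  have h2 := Finset.le_sup (f := fun i => Finset.univ.sup fun j => (A i j).natAbs)
    (Finset.mem_univ i)
  exact_mod_cast h1.trans h2

theorem one_le_two_pow_real (n : ℕ) : (1 : ℝ) ≤ 2 ^ n := one_le_pow₀ (by norm_num)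

/-- With `q = d * Δ`, the coefficient bound at height `n` is `q ^ (2 * d ^ (3 * (t - n)))`. An
elimination step multiplies its exponent by at most `d ^ 3`, because `d + 1 ≤ q ^ 2` and `2 * (d +
1) ≤ d ^ 3` for `d ≥ 2`. With `D = q ^ (3 * d ^ (3 * t + 1))`, the other two constants are `E = D ^
2` and `G = D ^ 3`. -/
theorem elimination_bounds {d q t : ℕ} (hd : 2 ≤ d) (hq : d ≤ q) :
    (∀ n < t, (d + 1) * ((d + 1) * q ^ (2 * d ^ (3 * (t - (n + 1))))) ^ d
        * q ^ (2 * d ^ (3 * (t - (n + 1)))) ≤ q ^ (2 * d ^ (3 * (t - n)))) ∧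
    (∀ n, (d + 1) * ((d + 1) * q ^ (2 * d ^ (3 * (t - n)))) ^ d ≤ (q ^ (3 * d ^ (3 * t + 1))) ^ 2) ∧
    (∀ n, d.factorial * (q ^ (2 * d ^ (3 * (t - n)))) ^ d ≤ q ^ (3 * d ^ (3 * t + 1))) ∧
    (∀ n, d * q ^ (3 * d ^ (3 * t + 1)) *
      (q ^ (2 * d ^ (3 * (t - n))) + d * q ^ (2 * d ^ (3 * (t - n)))) ≤
        (q ^ (3 * d ^ (3 * t + 1))) ^ 3) := by
  have hq1 : 1 ≤ q := by omega
  have hdq : d + 1 ≤ q ^ 2 := by nlinarith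
  have hle : ∀ n, d ^ (3 * (t - n)) ≤ d ^ (3 * t) := fun n =>
    Nat.pow_le_pow_right (by omega) (by omega)
  have hpos : 1 ≤ d ^ (3 * t) := Nat.one_le_pow _ _ (by omega)
  refine ⟨fun n hn => ?_, fun n => ?_, fun n => ?_, fun n => ?_⟩
  · set e := d ^ (3 * (t - (n + 1))) with he
    have he1 : 1 ≤ e := Nat.one_le_pow _ _ (by omega)
    have h1 : d ^ (3 * (t - n)) = d ^ 3 * e := by
      rw [he, ← pow_add]
      congr 1
      omega
    rw [h1]
    calc _ ≤ q ^ 2 * (q ^ 2 * q ^ (2 * e)) ^ d * q ^ (2 * e) := by gcongr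
      _ = q ^ ((2 + 2 * e) * (d + 1)) := by
        rw [← pow_add, ← pow_mul, ← pow_add, ← pow_add]
        congr 1
        ring
      _ ≤ _ := by
        refine Nat.pow_le_pow_right hq1 ?_
        have h2 : 2 * (d + 1) ≤ d ^ 3 := by
          have : 4 * d ≤ d ^ 3 := by
            calc 4 * d ≤ (d * d) * d := Nat.mul_le_mul_right _ (by nlinarith)
              _ = d ^ 3 := by ring
          omega
        calc (2 + 2 * e) * (d + 1) ≤ (4 * e) * (d + 1) := Nat.mul_le_mul_right _ (by omega)
          _ = 2 * e * (2 * (d + 1)) := by ring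
          _ ≤ 2 * e * d ^ 3 := Nat.mul_le_mul_left _ h2
          _ = 2 * (d ^ 3 * e) := by ring
  · have := hle n
    calc _ ≤ q ^ 2 * (q ^ 2 * q ^ (2 * d ^ (3 * t))) ^ d := by gcongr
      _ = q ^ (2 + (2 + 2 * d ^ (3 * t)) * d) := by
        rw [← pow_add, ← pow_mul, ← pow_add]
      _ ≤ q ^ (3 * d ^ (3 * t + 1) * 2) := by
        refine Nat.pow_le_pow_right hq1 ?_
        rw [pow_succ]
        nlinarith [Nat.mul_le_mul hpos (le_refl d)]
      _ = _ := by rw [pow_mul]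
  · have := hle n
    calc _ ≤ q ^ d * (q ^ (2 * d ^ (3 * t))) ^ d := by
          gcongr
          exact (Nat.factorial_le_pow d).trans (Nat.pow_le_pow_left hq d)
      _ = q ^ (d + 2 * d ^ (3 * t) * d) := by rw [← pow_mul, ← pow_add]
      _ ≤ _ := by
        refine Nat.pow_le_pow_right hq1 ?_
        rw [pow_succ]
        nlinarith [Nat.mul_le_mul hpos (le_refl d)]
  · have := hle n
    calc _ = q ^ (3 * d ^ (3 * t + 1)) * (d * (d + 1)) * q ^ (2 * d ^ (3 * (t - n))) := by ring
      _ ≤ q ^ (3 * d ^ (3 * t + 1)) * (q ^ 1 * q ^ 2) * q ^ (2 * d ^ (3 * t)) := by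
        gcongr
        simpa using hq
      _ = q ^ (3 * d ^ (3 * t + 1) + 3 + 2 * d ^ (3 * t)) := by ring
      _ ≤ q ^ (3 * d ^ (3 * t + 1) * 3) := by
        refine Nat.pow_le_pow_right hq1 ?_
        rw [pow_succ]
        nlinarith [Nat.mul_le_mul hpos hd]
      _ = _ := by rw [pow_mul]

/-- The left side is `(D! * D ^ 5) ^ (t + 1)`, which is at most `2 ^ (D ^ 4)`. As `D` has the factor
3 in its exponent, this yields the constant `C = 12`. -/
theorem total_bound {d q t : ℕ} (hd : 2 ≤ d) (hq : d ≤ q) :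
    ((q ^ (3 * d ^ (3 * t + 1))) ^ 2) ^ (t + 1) *
      ((q ^ (3 * d ^ (3 * t + 1))).factorial ^ (t + 1) *
        ((q ^ (3 * d ^ (3 * t + 1))) ^ 3) ^ (t + 1)) ≤ 2 ^ q ^ (12 * d ^ (3 * t + 1)) := by
  have hD4 : q ^ (12 * d ^ (3 * t + 1)) = (q ^ (3 * d ^ (3 * t + 1))) ^ 4 := by
    rw [← pow_mul]
    congr 1
    ring
  have hexp : 3 * t + 1 < d ^ (3 * t + 1) := Nat.lt_pow_self (by omega)
  have hD : 3 * d ^ (3 * t + 1) < q ^ (3 * d ^ (3 * t + 1)) := Nat.lt_pow_self (by omega)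
  rw [hD4]
  set D := q ^ (3 * d ^ (3 * t + 1))
  have ht : t + 1 ≤ D := by omega
  have hD5 : 5 ≤ D := by omega
  calc (D ^ 2) ^ (t + 1) * (D.factorial ^ (t + 1) * (D ^ 3) ^ (t + 1))
      = (D.factorial * D ^ 5) ^ (t + 1) := by
        rw [← mul_pow, ← mul_pow]
        congr 1
        ring
    _ ≤ (D ^ D * D ^ 5) ^ (t + 1) := by gcongr; exact Nat.factorial_le_pow D
    _ = D ^ ((D + 5) * (t + 1)) := by rw [← pow_add, ← pow_mul]
    _ ≤ (2 ^ D) ^ ((D + 5) * (t + 1)) := by gcongr; exact Nat.lt_two_pow_self.le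
    _ = 2 ^ (D * ((D + 5) * (t + 1))) := by rw [← pow_mul]
    _ ≤ 2 ^ (D ^ 4) := by
        refine Nat.pow_le_pow_right (by norm_num) ?_
        calc D * ((D + 5) * (t + 1)) ≤ D * ((D * D) * D) := by
              gcongr
              nlinarith
          _ = D ^ 4 := by ring

theorem MultistageTree.exists_conformal_kernel_vector_of_lt {m N : ℕ}
    {A : Matrix (Fin m) (Fin N) ℤ} {B : BlockDecomposition A} (T : MultistageTree B)
    {y : Fin N → ℝ} (hy : ∀ i, ∑ j, (A i j : ℝ) * y j = 0) {j : Fin N}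
    (hj : (2 : ℝ) ^ ((T.d * maxAbsEntry A) ^ (12 * T.d ^ (3 * T.t + 1))) < |y j|) :
    ∃ u : Fin N → ℤ, u ≠ 0 ∧ (∀ i, ∑ j, A i j * u j = 0) ∧
      ∀ i, 0 ≤ (u i : ℝ) * y i ∧ |(u i : ℝ)| ≤ |y i| := by
  by_cases hrow : ∀ i j j', A i j ≠ 0 → A i j' ≠ 0 → j = j'
  · exact exists_conformal_kernel_vector_of_row_subsingleton hrow hy
      ((one_le_two_pow_real _).trans_lt hj)
  · push Not at hrow
    obtain ⟨i, j₁, j₂, h₁, h₂, hne⟩ := hrow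
    -- Two nonzero entries in one row lie on a common root path.
    have hd : 2 ≤ T.d := by
      obtain ⟨k, hk⟩ := T.exists_row_support i
      calc 2 = ({j₁, j₂} : Finset (Fin N)).card := (Finset.card_pair hne).symm
        _ ≤ (T.pathColumns k).card := Finset.card_le_card (by
            intro l hl
            rcases Finset.mem_insert.1 hl with rfl | hl
            · exact hk _ h₁
            · rw [Finset.mem_singleton.1 hl]
              exact hk _ h₂)
        _ ≤ T.d := T.card_pathColumns_le k
    have hΔ : 1 ≤ maxAbsEntry A := by
      have := (Int.one_le_abs h₁).trans (abs_le_maxAbsEntry A i j₁)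
      exact_mod_cast this
    set q := T.d * maxAbsEntry A with hqdef
    have hq : T.d ≤ q := Nat.le_mul_of_pos_right _ hΔ
    have hq1 : 1 ≤ q := by omega
    obtain ⟨b1, b2, b3, b4⟩ := elimination_bounds (t := T.t) hd hq
    refine T.exists_conformal_kernel_vector (M := fun n => q ^ (2 * T.d ^ (3 * (T.t - n))))
      (D := q ^ (3 * T.d ^ (3 * T.t + 1))) (fun n => Nat.one_le_pow _ _ hq1) (fun n i j => ?_) b1
      (fun n _ => b2 n) (fun n _ => b3 n) (Nat.one_le_pow _ _ (Nat.one_le_pow _ _ hq1))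
      (fun n _ => b4 n) hy (j := j) (lt_of_le_of_lt ?_ hj)
    · refine (abs_le_maxAbsEntry A i j).trans ?_
      have h3 : maxAbsEntry A ≤ q := Nat.le_mul_of_pos_left _ (by omega)
      have h4 : q ≤ q ^ (2 * T.d ^ (3 * (T.t - n))) :=
        Nat.le_self_pow (Nat.mul_pos two_pos (pow_pos (by omega) _)).ne' q
      exact_mod_cast h3.trans h4
    · exact_mod_cast total_bound (t := T.t) hd hq

/-! ### From kernel vectors to proximity and optimal solutions. -/

namespace LinearProgram

variable {m N : ℕ} (P : LinearProgram m N)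

theorem sum_mul_sub_eq_zero {x : Fin N → ℝ} (hx : x ∈ P.fracSol) {z : Fin N → ℤ}
    (hz : z ∈ P.intSol) (i : Fin m) : ∑ j, (P.A i j : ℝ) * (toRealVec z - x) j = 0 := by
  have h1 : ∑ j, (P.A i j : ℝ) * (z j : ℝ) = P.b i := by exact_mod_cast hz.1 i
  simp only [Pi.sub_apply, toRealVec, mul_sub, Finset.sum_sub_distrib, h1, hx.1 i, sub_self]

/-- Integral kernel vectors dominated by large real kernel vectors bound the proximity. -/
theorem hasProximity_of_exists_kernel_vector {R : ℝ} (hR : 0 ≤ R)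
    (h : ∀ (y : Fin N → ℝ), (∀ i, ∑ j, (P.A i j : ℝ) * y j = 0) → ∀ j, R < |y j| →
      ∃ u : Fin N → ℤ, u ≠ 0 ∧ (∀ i, ∑ j, P.A i j * u j = 0) ∧
        ∀ i, 0 ≤ (u i : ℝ) * y i ∧ |(u i : ℝ)| ≤ |y i|) : P.HasProximity R := by
  intro x hx
  -- Induction on an integer bound for the ℓ₁-distance: subtracting a nonzero integral conformal `u`
  -- lowers it by `‖u‖₁ ≥ 1`.
  suffices H : ∀ (n : ℕ) (z : Fin N → ℤ), z ∈ P.intSol → ∑ j, |(z j : ℝ) - x j| ≤ n →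
      ∃ z' ∈ P.intSol, ‖toRealVec z' - x‖ ≤ R ∧
        IsConformalTo (toRealVec z' - x) (toRealVec z - x) by
    intro z hz
    obtain ⟨n, hn⟩ := exists_nat_ge (∑ j, |(z j : ℝ) - x j|)
    exact H n z hz hn
  intro n
  induction n with
  | zero =>
    intro z hz hn
    refine ⟨z, hz, ?_, fun j => ⟨mul_self_nonneg _, le_rfl⟩⟩
    rw [pi_norm_le_iff_of_nonneg hR]
    intro j
    have := Finset.single_le_sum (f := fun j => |(z j : ℝ) - x j|) (fun j _ => abs_nonneg _)
      (Finset.mem_univ j)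
    have h0 : |(z j : ℝ) - x j| ≤ 0 := this.trans (by simpa using hn)
    exact h0.trans hR
  | succ n ih =>
    intro z hz hn
    by_cases hsmall : ∀ j, |(toRealVec z - x) j| ≤ R
    · exact ⟨z, hz, (pi_norm_le_iff_of_nonneg hR).2 hsmall, fun j => ⟨mul_self_nonneg _, le_rfl⟩⟩
    push Not at hsmall
    obtain ⟨j, hj⟩ := hsmall
    obtain ⟨u, hu0, huA, hu⟩ := h _ (P.sum_mul_sub_eq_zero hx hz) j hj
    simp only [Pi.sub_apply, toRealVec] at hu
    have hcases : ∀ i, (0 ≤ (u i : ℝ) ∧ (u i : ℝ) ≤ z i - x i) ∨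
        ((u i : ℝ) ≤ 0 ∧ (z i : ℝ) - x i ≤ u i) := by
      intro i
      obtain ⟨h1, h2⟩ := hu i
      rcases lt_trichotomy ((z i : ℝ) - x i) 0 with h3 | h3 | h3
      · have h4 : (u i : ℝ) ≤ 0 := by
          by_contra! h5
          exact absurd (mul_neg_of_pos_of_neg h5 h3) (not_lt.2 h1)
        rw [abs_of_nonpos h4, abs_of_neg h3] at h2
        exact Or.inr ⟨h4, by linarith⟩
      · rw [h3, abs_zero] at h2
        have := abs_nonpos_iff.1 h2
        exact Or.inl ⟨this.ge, by rw [this, h3]⟩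
      · have h4 : 0 ≤ (u i : ℝ) := by
          by_contra! h5
          exact absurd (mul_neg_of_neg_of_pos h5 h3) (not_lt.2 h1)
        rw [abs_of_nonneg h4, abs_of_pos h3] at h2
        exact Or.inl ⟨h4, h2⟩
    have habs : ∀ i, |((z - u) i : ℝ) - x i| = |(z i : ℝ) - x i| - |(u i : ℝ)| := by
      intro i
      simp only [Pi.sub_apply, Int.cast_sub]
      rcases hcases i with ⟨h1, h2⟩ | ⟨h1, h2⟩
      · rw [abs_of_nonneg h1, abs_of_nonneg (by linarith), abs_of_nonneg (by linarith)]
        ring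
      · rw [abs_of_nonpos h1, abs_of_nonpos (by linarith), abs_of_nonpos (by linarith)]
        ring
    have hz' : z - u ∈ P.intSol := by
      refine ⟨fun i => ?_, fun i => ?_⟩
      · simp only [Pi.sub_apply, mul_sub, Finset.sum_sub_distrib, huA i, sub_zero]
        exact hz.1 i
      · have h1 : (0 : ℝ) ≤ z i := by exact_mod_cast hz.2 i
        have h2 := hx.2 i
        have : (0 : ℝ) ≤ z i - u i := by
          rcases hcases i with ⟨h3, h4⟩ | ⟨h3, h4⟩ <;> linarith
        simp only [Pi.sub_apply]
        exact_mod_cast this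
    have hu1 : (1 : ℝ) ≤ ∑ i, |(u i : ℝ)| := by
      obtain ⟨i, hi⟩ := Function.ne_iff.1 hu0
      have h1 : (1 : ℝ) ≤ |(u i : ℝ)| := by exact_mod_cast Int.one_le_abs hi
      exact h1.trans (Finset.single_le_sum (f := fun i => |(u i : ℝ)|) (fun i _ => abs_nonneg _)
        (Finset.mem_univ i))
    obtain ⟨z', hz'1, hz'2, hz'3⟩ := ih (z - u) hz' (by
      simp only [habs, Finset.sum_sub_distrib]
      push_cast at hn
      linarith)
    refine ⟨z', hz'1, hz'2, fun i => ?_⟩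
    obtain ⟨h1, h2⟩ := hz'3 i
    simp only [Pi.sub_apply, toRealVec] at h1 h2 ⊢
    have h3 := habs i
    simp only [Pi.sub_apply] at h3
    refine ⟨?_, h2.trans (by rw [h3]; linarith [abs_nonneg (u i : ℝ)])⟩
    rw [h3] at h2
    push_cast at h1
    rcases hcases i with ⟨h4, h5⟩ | ⟨h4, h5⟩
    · rw [abs_of_nonneg h4, abs_of_nonneg (h4.trans h5)] at h2
      rcases le_or_gt 0 ((z' i : ℝ) - x i) with h6 | h6
      · exact mul_nonneg h6 (h4.trans h5)
      · rw [abs_of_neg h6] at h2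
        rcases (sub_nonneg.2 h5).eq_or_lt with h7 | h7
        · linarith
        · have := mul_neg_of_neg_of_pos h6 h7
          nlinarith
    · rw [abs_of_nonpos h4, abs_of_nonpos (h5.trans h4)] at h2
      rcases le_or_gt ((z' i : ℝ) - x i) 0 with h6 | h6
      · exact mul_nonneg_of_nonpos_of_nonpos h6 (h5.trans h4)
      · rw [abs_of_pos h6] at h2
        rcases (sub_nonneg.2 h5).eq_or_lt with h7 | h7
        · linarith
        · have := mul_pos h6 h7
          nlinarith

/-- The integral objective values are integers bounded below by the value of the relaxation, so a
least one exists. -/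
theorem exists_isOptimalInt (hne : P.intSol.Nonempty) {x : Fin N → ℝ} (hx : P.IsOptimalFrac x) :
    ∃ z, P.IsOptimalInt z := by
  let f : (Fin N → ℤ) → ℤ := fun z => ∑ j, P.c j * z j
  have hbdd : ∀ v, v ∈ f '' P.intSol → ⌊∑ j, (P.c j : ℝ) * x j⌋ ≤ v := by
    rintro _ ⟨z, hz, rfl⟩
    have h1 := hx.2 (toRealVec z)
      ⟨fun i => by simp only [toRealVec]; exact_mod_cast hz.1 i,
        fun i => by simp only [toRealVec]; exact_mod_cast hz.2 i⟩
    have h2 := (Int.floor_le (∑ j, (P.c j : ℝ) * x j)).trans h1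
    simp only [toRealVec] at h2
    simp only [f]
    exact_mod_cast h2
  obtain ⟨z₀, hz₀⟩ := hne
  obtain ⟨v, ⟨z, hz, hzv⟩, hv⟩ := Int.exists_least_of_bdd (P := fun v => v ∈ f '' P.intSol)
    ⟨_, hbdd⟩ ⟨f z₀, z₀, hz₀, rfl⟩
  exact ⟨z, hz, fun y hy => hzv.trans_le (hv _ ⟨y, hy, rfl⟩)⟩

/-- Conformality places `z'` coordinatewise between `x` and an integral optimum `z`, so `x + z - z'`
is nonnegative and hence a fractional solution. Optimality of `x` against it says that `z'` costs no
more than `z`. -/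
theorem HasProximity.exists_isOptimalInt {P : LinearProgram m N} {R : ℝ} (h : P.HasProximity R)
    (hne : P.intSol.Nonempty) {x : Fin N → ℝ} (hx : P.IsOptimalFrac x) :
    ∃ z, P.IsOptimalInt z ∧ ‖toRealVec z - x‖ ≤ R := by
  obtain ⟨z, hz⟩ := P.exists_isOptimalInt hne hx
  obtain ⟨z', hz', hR, hconf⟩ := h x hx.1 z hz.1
  refine ⟨z', ⟨hz', fun y hy => le_trans ?_ (hz.2 y hy)⟩, hR⟩
  have h1 := hx.2 (fun j => x j + ((z j : ℝ) - z' j)) ⟨fun i => by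
      have e1 : ∑ j, (P.A i j : ℝ) * (z j : ℝ) = P.b i := by exact_mod_cast hz.1.1 i
      have e2 : ∑ j, (P.A i j : ℝ) * (z' j : ℝ) = P.b i := by exact_mod_cast hz'.1 i
      simp only [mul_add, mul_sub, Finset.sum_add_distrib, Finset.sum_sub_distrib, e1, e2,
        hx.1.1 i, sub_self, add_zero], fun j => by
      have hz0 : (0 : ℝ) ≤ z j := by exact_mod_cast hz.1.2 j
      have hx0 := hx.1.2 j
      obtain ⟨h2, h3⟩ := hconf j
      simp only [Pi.sub_apply, toRealVec] at h2 h3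
      rcases le_total 0 ((z j : ℝ) - x j) with h4 | h4
      · rw [abs_of_nonneg h4] at h3
        linarith [le_abs_self ((z' j : ℝ) - x j)]
      · by_contra! h5
        have h6 : 0 < (z' j : ℝ) - x j := by linarith
        rcases h4.eq_or_lt with h7 | h7
        · rw [h7, abs_zero] at h3
          exact h6.ne' (abs_nonpos_iff.1 h3)
        · exact absurd (mul_neg_of_pos_of_neg h6 h7) (not_lt.2 h2)⟩
  simp only [mul_add, mul_sub, Finset.sum_add_distrib, Finset.sum_sub_distrib] at h1
  have h2 : ∑ j, (P.c j : ℝ) * (z' j : ℝ) ≤ ∑ j, (P.c j : ℝ) * (z j : ℝ) := by linarith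
  exact_mod_cast h2

end LinearProgram

theorem lemma2p4 :
    ∃ C : ℕ, ∀ (m N : ℕ) (P : LinearProgram m N) (B : BlockDecomposition P.A)
      (T : MultistageTree B),
      P.proximity ≤ (2 : ℝ≥0∞) ^ ((T.d * maxAbsEntry P.A) ^ (C * T.d ^ (3 * T.t + 1))) ∧
      P.HasProximity
        ((2 : ℝ) ^ ((T.d * maxAbsEntry P.A) ^ (C * T.d ^ (3 * T.t + 1)))) ∧
      (P.intSol.Nonempty → ∀ x : Fin N → ℝ, P.IsOptimalFrac x →
        ∃ z : Fin N → ℤ, P.IsOptimalInt z ∧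
          ‖toRealVec z - x‖ ≤
            (2 : ℝ) ^ ((T.d * maxAbsEntry P.A) ^ (C * T.d ^ (3 * T.t + 1)))) := by
  refine ⟨12, fun m N P B T => ?_⟩
  have h : P.HasProximity
      ((2 : ℝ) ^ ((T.d * maxAbsEntry P.A) ^ (12 * T.d ^ (3 * T.t + 1)))) :=
    P.hasProximity_of_exists_kernel_vector (by positivity) fun y hy j hj =>
      T.exists_conformal_kernel_vector_of_lt hy hj
  refine ⟨?_, h, fun hne x hx => h.exists_isOptimalInt hne hx⟩
  refine (iInf₂_le ((2 : ℝ≥0) ^ ((T.d * maxAbsEntry P.A) ^ (12 * T.d ^ (3 * T.t + 1))))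
    (by simpa using h)).trans_eq ?_
  simp
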